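/- Let $n\ge 1$ agents have local objectives $f_i:\mathbb{R}^r\to\mathbb{R}$ that are differentiable, $\mu$-strongly convex and have $L$-Lipschitz gradients ($\mu,L>0$), i.e. $\langle\nabla f_i(x)-\nabla f_i(x'),x-x'\rangle\ge\mu\|x-x'\|^2$ and $\|\nabla f_i(x)-\nabla f_i(x')\|\le L\|x-x'\|$ for all $x,x'\in\mathbb{R}^r$, and let $x^*$ be the minimizer of $f=\frac1n\sum_{i=1}^n f_i$. Let $W=[w_{ij}]\in\mathbb{R}^{n\times n}$ be nonnegative, symmetric and doubly stochastic with $w_{ii}>0$ for all $i$, such that the graph with an edge between $i\ne j$ whenever $w_{ij}>0$ is connected. Let the random vectors $\eta_{i,k},\xi_{i,k}\in\mathbb{R}^r$ ($1\le i\le n$, $k\ge0$) have mutually independent entries (over iterations, agents, coordinates and between $\eta$ and $\xi$) with mean zero, finite variances, and $\mathbb{E}\sum_i\|\eta_{i,k}\|^2\le\sigma_\eta^2$, $\mathbb{E}\sum_i\|\xi_{i,k}\|^2\le\sigma_\xi^2$ for all $k$, where $\sigma_\eta,\sigma_\xi>0$. From arbitrary deterministic $s_{i,0},x_{i,0}\in\mathbb{R}^r$,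 the algorithm iterates $$s_{i,k+1}=w_{ii}s_{i,k}+\sum_{j\ne i}w_{ij}(s_{j,k}+\beta_k\eta_{j,k})+\gamma_k\nabla f_i(x_{i,k}),$$ $$x_{i,k+1}=w_{ii}x_{i,k}+\sum_{j\ne i}w_{ij}(x_{j,k}+\beta_k\xi_{j,k})-\alpha(s_{i,k+1}-s_{i,k}),$$ with $\gamma_k=\gamma/(m+k)^p$, $\beta_k=1/(m+k)^q$, $\alpha,\gamma>0$, $m>0$. Put $y_{i,k}=s_{i,k+1}-s_{i,k}$, $\bar x_k=\frac1n\sum_i x_{i,k}$, $\bar y_k=\frac1n\sum_i y_{i,k}$. Let $p=0$ (so $\gamma_k=\gamma$), let $\rho_w$ be the spectral radius of $W-\frac{\mathbf 1\mathbf 1^T}{n}$ and $d_I=\|I-\frac{\mathbf 1\mathbf 1^T}{n}\|$ in the Frobenius norm (so $d_I^2=n-1$), and suppose $$\alpha\gamma<\min\left\{\frac{2}{\mu+L},\ \frac{1-\rho_w^2}{4\sqrt2\,L\,d_I},\ \sqrt{\frac{2}{c_{42}+\sqrt{c_{42}^2+4c_{41}}}}\right\},$$ $$c_{41}=\frac{64(1+\rho_w^2)(3\mu+L)L^6d_I^2}{(1-\rho_w^2)^4(\mu+L)},\qquad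 c_{42}=\frac{64(1+\rho_w^2)(\mu^2+2\mu L+5L^2)L^2d_I^2}{(1-\rho_w^2)^4(\mu+L)^2}$$ (for $n=1$ the last two terms of the minimum are $+\infty$). Then there are constants $a\in(0,1)$ and $C>0$, independent of $k$ and $q$, such that for all sufficiently large $q$ the following holds with the $m>0$ determined by $\left(\frac{m}{m+1}\right)^{2q}=a$: for all integers $0\le k\le q$, the three expectations below are finite and $$\mathbb{E}\|\bar x_k-x^*\|^2\le C\,e^{-\frac{4k}{2+\ln(1/a)}},\qquad \mathbb{E}\sum_{i}\|x_{i,k}-\bar x_k\|^2\le C\,e^{-\frac{4k}{2+\ln(1/a)}},\qquad \mathbb{E}\sum_{i}\|y_{i,k}-\bar y_k\|^2\le C\,e^{-\frac{4k}{2+\ln(1/a)}}.$$ -/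

import Mathlib

open MeasureTheory ProbabilityTheory Filter

namespace DPGradTracking

noncomputable section

/-- Decision variables live in `ℝ^r` with the Euclidean norm. -/
abbrev Vec (r : ℕ) : Type := EuclideanSpace ℝ (Fin r)

/-- The global objective `f = (1/n) ∑ᵢ fᵢ`. -/
def globalObj {n r : ℕ} (f : Fin n → Vec r → ℝ) (x : Vec r) : ℝ :=
  (1 / (n : ℝ)) * ∑ i, f i x

/-- Each `fᵢ` is differentiable and `μ`-strongly convex with an `L`-Lipschitz gradient. -/
structure ObjectiveAssumption {n r : ℕ} (f : Fin n → Vec r → ℝ) (μ L : ℝ) : Prop where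
  mu_pos : 0 < μ
  L_pos : 0 < L
  differentiable : ∀ i, Differentiable ℝ (f i)
  strong : ∀ i x x', μ * ‖x - x'‖ ^ 2 ≤ inner ℝ (gradient (f i) x - gradient (f i) x') (x - x')
  lipschitz : ∀ i x x', ‖gradient (f i) x - gradient (f i) x'‖ ≤ L * ‖x - x'‖

/-- The communication graph induced by `W`: distinct agents are linked iff their weight is positive
(`W` is symmetric wherever this is used). -/
def commGraph {n : ℕ} (W : Matrix (Fin n) (Fin n) ℝ) : SimpleGraph (Fin n) :=
  SimpleGraph.fromRel fun i j => 0 < W i j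

/-- The coupling matrix is nonnegative, doubly stochastic and symmetric, has a positive diagonal,
and its graph is connected. -/
structure NetworkAssumption {n : ℕ} (W : Matrix (Fin n) (Fin n) ℝ) : Prop where
  nonneg : ∀ i j, 0 ≤ W i j
  row_sum : ∀ i, ∑ j, W i j = 1
  col_sum : ∀ j, ∑ i, W i j = 1
  symm : W.IsSymm
  diag_pos : ∀ i, 0 < W i i
  connected : (commGraph W).Connected

/-- All scalar noise entries `η_{ij,k}`, `ξ_{ij,k}` are mutually independent (over iterations `k`,
agents `i`, coordinates `j`), have mean zero and finite variance, and
`𝔼‖η_k‖² ≤ σ_η²`, `𝔼‖ξ_k‖² ≤ σ_ξ²`. -/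
structure NoiseAssumption {n r : ℕ} {Ω : Type*} [MeasurableSpace Ω] (P : Measure Ω)
    (η ξ : ℕ → Fin n → Ω → Vec r) (ση σξ : ℝ) : Prop where
  indep : iIndepFun
    (fun (z : (ℕ × Fin n × Fin r) ⊕ (ℕ × Fin n × Fin r)) (ω : Ω) =>
      Sum.elim (fun t => η t.1 t.2.1 ω t.2.2) (fun t => ξ t.1 t.2.1 ω t.2.2) z) P
  memLp_eta : ∀ k i j, MemLp (fun ω => η k i ω j) 2 P
  memLp_xi : ∀ k i j, MemLp (fun ω => ξ k i ω j) 2 P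
  mean_eta : ∀ k i j, ∫ ω, η k i ω j ∂P = 0
  mean_xi : ∀ k i j, ∫ ω, ξ k i ω j ∂P = 0
  sigma_eta_pos : 0 < ση
  sigma_xi_pos : 0 < σξ
  var_eta : ∀ k, ∫ ω, ∑ i, ‖η k i ω‖ ^ 2 ∂P ≤ ση ^ 2
  var_xi : ∀ k, ∫ ω, ∑ i, ‖ξ k i ω‖ ^ 2 ∂P ≤ σξ ^ 2

/-- Step sizes `γ_k = γ / (m + k)^p`. -/
def gammaSeq (γ m p : ℝ) (k : ℕ) : ℝ := γ / (m + k) ^ p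

/-- Noise factors `β_k = 1 / (m + k)^q`. -/
def betaSeq (m q : ℝ) (k : ℕ) : ℝ := 1 / (m + k) ^ q

/-- The algorithm, for given noise values: `algState … k = (s_k, x_k)`, the agents' tracking
variables and decision variables after `k` iterations. -/
def algState {n r : ℕ} (W : Matrix (Fin n) (Fin n) ℝ) (f : Fin n → Vec r → ℝ)
    (α : ℝ) (γ β : ℕ → ℝ) (s₀ x₀ : Fin n → Vec r) (η ξ : ℕ → Fin n → Vec r) :
    ℕ → (Fin n → Vec r) × (Fin n → Vec r)
  | 0 => (s₀, x₀)
  | k + 1 =>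
    let s := (algState W f α γ β s₀ x₀ η ξ k).1
    let x := (algState W f α γ β s₀ x₀ η ξ k).2
    let s' : Fin n → Vec r := fun i =>
      W i i • s i + ∑ j ∈ Finset.univ.erase i, W i j • (s j + β k • η k j)
        + γ k • gradient (f i) (x i)
    let x' : Fin n → Vec r := fun i =>
      W i i • x i + ∑ j ∈ Finset.univ.erase i, W i j • (x j + β k • ξ k j)
        - α • (s' i - s i)
    (s', x')

/-- The tracking variables `s_k`, as random vectors. -/
def sIter {n r : ℕ} {Ω : Type*} (W : Matrix (Fin n) (Fin n) ℝ) (f : Fin n → Vec r → ℝ)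
    (α : ℝ) (γ β : ℕ → ℝ) (s₀ x₀ : Fin n → Vec r) (η ξ : ℕ → Fin n → Ω → Vec r)
    (k : ℕ) (ω : Ω) : Fin n → Vec r :=
  (algState W f α γ β s₀ x₀ (fun l i => η l i ω) (fun l i => ξ l i ω) k).1

/-- The decision variables `x_k`, as random vectors. -/
def xIter {n r : ℕ} {Ω : Type*} (W : Matrix (Fin n) (Fin n) ℝ) (f : Fin n → Vec r → ℝ)
    (α : ℝ) (γ β : ℕ → ℝ) (s₀ x₀ : Fin n → Vec r) (η ξ : ℕ → Fin n → Ω → Vec r)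
    (k : ℕ) (ω : Ω) : Fin n → Vec r :=
  (algState W f α γ β s₀ x₀ (fun l i => η l i ω) (fun l i => ξ l i ω) k).2

/-- The gradient trackers `y_k = s_{k+1} - s_k`. -/
def yIter {n r : ℕ} {Ω : Type*} (W : Matrix (Fin n) (Fin n) ℝ) (f : Fin n → Vec r → ℝ)
    (α : ℝ) (γ β : ℕ → ℝ) (s₀ x₀ : Fin n → Vec r) (η ξ : ℕ → Fin n → Ω → Vec r)
    (k : ℕ) (ω : Ω) : Fin n → Vec r :=
  sIter W f α γ β s₀ x₀ η ξ (k + 1) ω - sIter W f α γ β s₀ x₀ η ξ k ω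

/-- The average over agents, `(1/n) 1ᵀ z`. -/
def agentAvg {n r : ℕ} (z : Fin n → Vec r) : Vec r := (1 / (n : ℝ)) • ∑ i, z i

/-- The squared consensus error `‖z - 1 z̄‖₂²`, for the matrix norm `matNorm` below. -/
def consensusSq {n r : ℕ} (z : Fin n → Vec r) : ℝ := ∑ i, ‖z i - agentAvg z‖ ^ 2

/-- The averaging matrix `11ᵀ/n`. -/
def avgMatrix (n : ℕ) : Matrix (Fin n) (Fin n) ℝ := Matrix.of fun _ _ => 1 / (n : ℝ)

/-- The matrix norm `‖A‖₂`: the 2-norm of the vector of the 2-norms of the columns. -/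
def matNorm {n r : ℕ} (A : Matrix (Fin n) (Fin r) ℝ) : ℝ :=
  Real.sqrt (∑ j, ∑ i, A i j ^ 2)

/-- `d_I = ‖I - 11ᵀ/n‖₂`. -/
def dI (n : ℕ) : ℝ := matNorm (1 - avgMatrix n)

/-- `ρ_w`, the spectral radius of `W - 11ᵀ/n`; this matrix is symmetric under
`NetworkAssumption`, so that its spectrum is real. -/
def rhoW {n : ℕ} (W : Matrix (Fin n) (Fin n) ℝ) : ℝ :=
  (spectralRadius ℝ (W - avgMatrix n)).toReal

/-- The constant `c₄₁`. -/
def c41 {n : ℕ} (W : Matrix (Fin n) (Fin n) ℝ) (μ L : ℝ) : ℝ :=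
  64 * (1 + rhoW W ^ 2) * (3 * μ + L) * L ^ 6 * dI n ^ 2
    / ((1 - rhoW W ^ 2) ^ 4 * (μ + L))

/-- The constant `c₄₂`. -/
def c42 {n : ℕ} (W : Matrix (Fin n) (Fin n) ℝ) (μ L : ℝ) : ℝ :=
  64 * (1 + rhoW W ^ 2) * (μ ^ 2 + 2 * μ * L + 5 * L ^ 2) * L ^ 2 * dI n ^ 2
    / ((1 - rhoW W ^ 2) ^ 4 * (μ + L) ^ 2)

/-- The bound `αγ < min {2/(μ+L), (1-ρ_w²)/(4√2 L d_I), √(2/(c₄₂+√(c₄₂²+4c₄₁)))}`. For `n = 1`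
one has `d_I = c₄₁ = c₄₂ = 0`, and the last two terms are read as `+∞`. -/
def StepsizeCondition {n : ℕ} (W : Matrix (Fin n) (Fin n) ℝ) (μ L α γ : ℝ) : Prop :=
  α * γ < 2 / (μ + L) ∧
    (1 < n →
      α * γ < (1 - rhoW W ^ 2) / (4 * Real.sqrt 2 * L * dI n) ∧
      α * γ < Real.sqrt (2 / (c42 W μ L + Real.sqrt (c42 W μ L ^ 2 + 4 * c41 W μ L))))

end

end DPGradTracking

open DPGradTracking

open DPGradTracking

/-! Let `z_k = (W - I) s_k + γ ∇F(x_k)` be the noise-free part of `y_k` (`tracker`). Without noise,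
the pair `(x, z)` follows the gradient-tracking recursion `x' = W x - α z`, `z' = W z + γ (∇F(x') -
∇F(x))`, and double stochasticity keeps the average of `z` equal to `γ` times the averaged local
gradients. A weighted sum `V` of the optimality gap and the two consensus errors shrinks by a fixed
factor `lam < 1` per iteration (`exists_lyapunov_contraction`): the descent lemma and the
Polyak–Łojasiewicz inequality treat the gap, the spectral gap of `W` treats the consensus errors,
and the stepsize bound keeps the coupling between them small.

Noise perturbs `(x, z)` additively, with a factor `β_k`. Young's inequality absorbs it at the price
of a slightly larger `lam`, so that on every path `V_k ≤ lam ^ k V_0 + K ∑ β_l² ‖noise_l‖²`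
(`exists_pathwise_bound`). Taking expectations inserts the variance bounds.

Since `lam` does not depend on `m` or `q`, one may take `a = exp (-M)` with `lam = exp (-4 / M)`;
then `lam ^ k` is below the claimed rate. As `q` grows with `a` fixed, `m` tends to infinity. Once
`m ≥ e²`, every `β_l²` is at most `exp (-4q)`, and the noise accumulated up to `k ≤ q` is of order
`exp (-2k)`, again below the claimed rate. -/

/-- The squared Euclidean norm of a stack of vectors. -/
noncomputable def nsq {n r : ℕ} (z : Fin n → Vec r) : ℝ := ∑ i, ‖z i‖ ^ 2

/-- The action of an agent-by-agent matrix on a stack of vectors. -/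
noncomputable def mix {n r : ℕ} (M : Matrix (Fin n) (Fin n) ℝ) (z : Fin n → Vec r) :
    Fin n → Vec r := fun i => ∑ j, M i j • z j

/-- The deviations from the average over agents. -/
noncomputable def dev {n r : ℕ} (z : Fin n → Vec r) : Fin n → Vec r := fun i => z i - agentAvg z

/-! ### Averages, deviations, and contraction of deviations by `W`. -/

section LinearAlgebra

variable {n r : ℕ}

theorem nsq_nonneg (z : Fin n → Vec r) : 0 ≤ nsq z := Finset.sum_nonneg fun _ _ => sq_nonneg _

theorem consensusSq_eq_nsq_dev (z : Fin n → Vec r) : consensusSq z = nsq (dev z) := rfl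

theorem nsq_smul (c : ℝ) (z : Fin n → Vec r) : nsq (c • z) = c ^ 2 * nsq z := by
  simp [nsq, Finset.mul_sum, norm_smul, mul_pow]

theorem norm_add_sq_le_of_pos {E : Type*} [NormedAddCommGroup E] {c : ℝ} (hc : 0 < c) (a b : E) :
    ‖a + b‖ ^ 2 ≤ (1 + c) * ‖a‖ ^ 2 + (1 + 1 / c) * ‖b‖ ^ 2 := by
  have h : ‖a + b‖ ^ 2 ≤ (‖a‖ + ‖b‖) ^ 2 := pow_le_pow_left₀ (norm_nonneg _) (norm_add_le a b) 2
  have h2 : 0 ≤ (c * ‖a‖ - ‖b‖) ^ 2 / c := by positivity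
  have h3 : (c * ‖a‖ - ‖b‖) ^ 2 / c = c * ‖a‖ ^ 2 - 2 * ‖a‖ * ‖b‖ + 1 / c * ‖b‖ ^ 2 := by
    field_simp
    ring
  linarith

theorem nsq_add_le {c : ℝ} (hc : 0 < c) (a b : Fin n → Vec r) :
    nsq (a + b) ≤ (1 + c) * nsq a + (1 + 1 / c) * nsq b := by
  unfold nsq
  rw [Finset.mul_sum, Finset.mul_sum, ← Finset.sum_add_distrib]
  exact Finset.sum_le_sum fun i _ => norm_add_sq_le_of_pos hc (a i) (b i)

theorem nsq_add_le_two (a b : Fin n → Vec r) : nsq (a + b) ≤ 2 * nsq a + 2 * nsq b := by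
  have := nsq_add_le one_pos a b
  norm_num at this
  exact this

theorem nsq_sub_le_two (a b : Fin n → Vec r) : nsq (a - b) ≤ 2 * nsq a + 2 * nsq b := by
  have h := nsq_add_le_two a (-b)
  have h2 : nsq (-b) = nsq b := by simp [nsq]
  rwa [← sub_eq_add_neg, h2] at h

theorem nsq_eq_zero_iff (a : Fin n → Vec r) : nsq a = 0 ↔ a = 0 := by
  unfold nsq
  rw [Finset.sum_eq_zero_iff_of_nonneg fun _ _ => sq_nonneg _]
  simp [funext_iff]

theorem agentAvg_add (a b : Fin n → Vec r) : agentAvg (a + b) = agentAvg a + agentAvg b := by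
  simp [agentAvg, Finset.sum_add_distrib]

theorem agentAvg_smul (c : ℝ) (a : Fin n → Vec r) : agentAvg (c • a) = c • agentAvg a := by
  simp [agentAvg, ← Finset.smul_sum, smul_comm c]

theorem agentAvg_sub (a b : Fin n → Vec r) : agentAvg (a - b) = agentAvg a - agentAvg b := by
  simp [agentAvg, smul_sub]

theorem dev_add (a b : Fin n → Vec r) : dev (a + b) = dev a + dev b := by
  funext i
  simp only [dev, agentAvg_add, Pi.add_apply]
  abel

theorem dev_sub (a b : Fin n → Vec r) : dev (a - b) = dev a - dev b := by
  funext i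
  simp only [dev, agentAvg_sub, Pi.sub_apply]
  abel

theorem dev_smul (c : ℝ) (a : Fin n → Vec r) : dev (c • a) = c • dev a := by
  funext i
  simp only [dev, agentAvg_smul, Pi.smul_apply, smul_sub]

theorem sum_eq_smul_agentAvg (hn : 0 < n) (z : Fin n → Vec r) :
    ∑ i, z i = (n : ℝ) • agentAvg z := by
  have : (n : ℝ) ≠ 0 := by positivity
  simp [agentAvg, smul_smul, this]

/-- Pythagoras: the deviations are orthogonal to the constant stacks. -/
theorem nsq_eq_consensusSq_add (hn : 0 < n) (z : Fin n → Vec r) :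
    nsq z = consensusSq z + n * ‖agentAvg z‖ ^ 2 := by
  have h : ∀ i, ‖z i - agentAvg z‖ ^ 2
      = ‖z i‖ ^ 2 - 2 * inner ℝ (z i) (agentAvg z) + ‖agentAvg z‖ ^ 2 := fun i =>
    norm_sub_sq_real _ _
  unfold consensusSq nsq
  simp only [h, Finset.sum_add_distrib, Finset.sum_sub_distrib, ← Finset.mul_sum,
    ← sum_inner, sum_eq_smul_agentAvg hn z, real_inner_smul_left, real_inner_self_eq_norm_sq]
  simp
  ring

theorem consensusSq_nonneg (z : Fin n → Vec r) : 0 ≤ consensusSq z := nsq_nonneg (dev z)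

theorem consensusSq_le_nsq (hn : 0 < n) (z : Fin n → Vec r) : consensusSq z ≤ nsq z := by
  have := nsq_eq_consensusSq_add hn z
  have : 0 ≤ n * ‖agentAvg z‖ ^ 2 := by positivity
  linarith

theorem norm_agentAvg_sq_le (hn : 0 < n) (z : Fin n → Vec r) :
    n * ‖agentAvg z‖ ^ 2 ≤ nsq z := by
  have := nsq_eq_consensusSq_add hn z
  have := consensusSq_nonneg z
  linarith

theorem consensusSq_of_card_one (z : Fin 1 → Vec r) : consensusSq z = 0 := by
  simp [consensusSq, agentAvg]

theorem mix_add (M : Matrix (Fin n) (Fin n) ℝ) (a b : Fin n → Vec r) :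
    mix M (a + b) = mix M a + mix M b := by
  funext i
  simp [mix, Finset.sum_add_distrib]

theorem mix_sub (M : Matrix (Fin n) (Fin n) ℝ) (a b : Fin n → Vec r) :
    mix M (a - b) = mix M a - mix M b := by
  funext i
  simp [mix, smul_sub]

theorem mix_smul (M : Matrix (Fin n) (Fin n) ℝ) (c : ℝ) (a : Fin n → Vec r) :
    mix M (c • a) = c • mix M a := by
  funext i
  simp [mix, Finset.smul_sum, smul_comm c]

theorem agentAvg_mix {W : Matrix (Fin n) (Fin n) ℝ} (hW : ∀ j, ∑ i, W i j = 1)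
    (z : Fin n → Vec r) : agentAvg (mix W z) = agentAvg z := by
  unfold agentAvg mix
  rw [Finset.sum_comm]
  simp [← Finset.sum_smul, hW]

theorem mix_const {W : Matrix (Fin n) (Fin n) ℝ} (hW : ∀ i, ∑ j, W i j = 1) (v : Vec r) :
    mix W (fun _ => v) = fun _ => v := by
  funext i
  simp [mix, ← Finset.sum_smul, hW]

theorem mix_avgMatrix (z : Fin n → Vec r) : mix (avgMatrix n) z = fun _ => agentAvg z := by
  funext i
  simp [mix, avgMatrix, agentAvg, Finset.smul_sum]

theorem mix_matrix_sub (A B : Matrix (Fin n) (Fin n) ℝ) (z : Fin n → Vec r) :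
    mix (A - B) z = mix A z - mix B z := by
  funext i
  simp [mix, sub_smul]

theorem agentAvg_dev (hn : 0 < n) (z : Fin n → Vec r) : agentAvg (dev z) = 0 := by
  have h : ((n : ℝ)⁻¹ * n) = 1 := by
    have : (n : ℝ) ≠ 0 := by positivity
    field_simp
  have h2 : ∑ i, dev z i = 0 := by
    simp only [dev, Finset.sum_sub_distrib, sum_eq_smul_agentAvg hn z]
    simp [← Nat.cast_smul_eq_nsmul ℝ]
  simp [agentAvg, h2]

theorem dev_mix (hn : 0 < n) {W : Matrix (Fin n) (Fin n) ℝ} (hc : ∀ j, ∑ i, W i j = 1)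
    (hr : ∀ i, ∑ j, W i j = 1) (z : Fin n → Vec r) :
    dev (mix W z) = mix (W - avgMatrix n) (dev z) := by
  rw [mix_matrix_sub, mix_avgMatrix, agentAvg_dev hn]
  have : dev z = z - fun _ => agentAvg z := rfl
  rw [this, mix_sub, mix_const hr]
  funext i
  simp [dev, agentAvg_mix hc]

theorem norm_sum_smul_sq_le (c : Fin n → ℝ) (z : Fin n → Vec r) :
    ‖∑ j, c j • z j‖ ^ 2 ≤ (∑ j, c j ^ 2) * nsq z := by
  have h1 : ‖∑ j, c j • z j‖ ≤ ∑ j, |c j| * ‖z j‖ :=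
    (norm_sum_le _ _).trans (le_of_eq (by simp [norm_smul]))
  calc ‖∑ j, c j • z j‖ ^ 2 ≤ (∑ j, |c j| * ‖z j‖) ^ 2 :=
        pow_le_pow_left₀ (norm_nonneg _) h1 2
    _ ≤ (∑ j, |c j| ^ 2) * ∑ j, ‖z j‖ ^ 2 := Finset.sum_mul_sq_le_sq_mul_sq _ _ _
    _ = _ := by simp [nsq]

theorem nsq_mix_le (M : Matrix (Fin n) (Fin n) ℝ) (z : Fin n → Vec r) :
    nsq (mix M z) ≤ (∑ i, ∑ j, M i j ^ 2) * nsq z := by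
  rw [Finset.sum_mul]
  exact Finset.sum_le_sum fun i _ => norm_sum_smul_sq_le _ _

/-- The spectrum is finite, so the supremum defining the spectral radius is not `⊤` and `toReal`
loses nothing. -/
theorem abs_eigenvalues_le_spectralRadius {A : Matrix (Fin n) (Fin n) ℝ} (hA : A.IsHermitian)
    (i : Fin n) : |hA.eigenvalues i| ≤ (spectralRadius ℝ A).toReal := by
  have hfin : spectralRadius ℝ A ≠ ⊤ := by
    unfold spectralRadius
    have hf : (spectrum ℝ A).Finite := A.finite_real_spectrum
    obtain ⟨B, hB⟩ := (hf.image fun k : ℝ => ‖k‖₊).bddAbove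
    refine ne_top_of_le_ne_top (ENNReal.coe_ne_top (r := B)) (iSup₂_le fun k hk => ?_)
    exact ENNReal.coe_le_coe.2 (hB ⟨k, hk, rfl⟩)
  have h : (‖hA.eigenvalues i‖₊ : ENNReal) ≤ spectralRadius ℝ A :=
    le_iSup₂ (f := fun (k : ℝ) (_ : k ∈ spectrum ℝ A) => (‖k‖₊ : ENNReal)) _
      (hA.eigenvalues_mem_spectrum_real i)
  simpa using ENNReal.toReal_mono hfin h

/-- Parseval in an orthonormal eigenbasis, where `A` multiplies each coordinate by an eigenvalue. -/
theorem sum_mulVec_sq_le {A : Matrix (Fin n) (Fin n) ℝ} (hA : A.IsHermitian) (v : Fin n → ℝ) :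
    ∑ i, (A.mulVec v) i ^ 2 ≤ (spectralRadius ℝ A).toReal ^ 2 * ∑ i, v i ^ 2 := by
  have hsq : ∀ w : Fin n → ℝ,
      ∑ i, w i ^ 2 = ∑ i, (inner ℝ (hA.eigenvectorBasis i) (WithLp.toLp 2 w)) ^ 2 := fun w => by
    have := hA.eigenvectorBasis.sum_sq_norm_inner_right (WithLp.toLp 2 w)
    rw [EuclideanSpace.norm_sq_eq] at this
    simpa using this.symm
  rw [hsq, hsq v, Finset.mul_sum]
  refine Finset.sum_le_sum fun i _ => ?_
  have hin : inner ℝ (hA.eigenvectorBasis i) (WithLp.toLp 2 (A.mulVec v))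
      = hA.eigenvalues i * inner ℝ (hA.eigenvectorBasis i) (WithLp.toLp 2 v) := by
    have hT : A.transpose = A := hA
    simp only [EuclideanSpace.inner_eq_star_dotProduct, star_trivial]
    rw [dotProduct_comm, Matrix.dotProduct_mulVec, ← Matrix.mulVec_transpose, hT,
      hA.mulVec_eigenvectorBasis, smul_dotProduct, dotProduct_comm, smul_eq_mul]
  rw [hin, mul_pow]
  refine mul_le_mul_of_nonneg_right ?_ (sq_nonneg _)
  rw [← sq_abs]
  exact pow_le_pow_left₀ (abs_nonneg _) (abs_eigenvalues_le_spectralRadius hA i) 2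

theorem nsq_eq_sum_coord (z : Fin n → Vec r) : nsq z = ∑ c, ∑ i, z i c ^ 2 := by
  rw [Finset.sum_comm]
  simp [nsq, EuclideanSpace.norm_sq_eq]

theorem nsq_mix_le_spectralRadius {A : Matrix (Fin n) (Fin n) ℝ} (hA : A.IsHermitian)
    (z : Fin n → Vec r) : nsq (mix A z) ≤ (spectralRadius ℝ A).toReal ^ 2 * nsq z := by
  rw [nsq_eq_sum_coord, nsq_eq_sum_coord, Finset.mul_sum]
  refine Finset.sum_le_sum fun c _ => ?_
  refine le_trans (le_of_eq (Finset.sum_congr rfl fun i _ => ?_))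
    (sum_mulVec_sq_le hA fun i => z i c)
  simp [mix, Matrix.mulVec, dotProduct]

theorem isHermitian_sub_avgMatrix {W : Matrix (Fin n) (Fin n) ℝ} (hW : W.IsSymm) :
    (W - avgMatrix n).IsHermitian := by
  refine Matrix.IsHermitian.ext fun i j => ?_
  simp [avgMatrix, hW.apply i j]

theorem consensusSq_mix_le {W : Matrix (Fin n) (Fin n) ℝ} (hW : NetworkAssumption W) (hn : 0 < n)
    (z : Fin n → Vec r) : nsq (dev (mix W z)) ≤ rhoW W ^ 2 * consensusSq z := by
  rw [dev_mix hn hW.col_sum hW.row_sum]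
  exact nsq_mix_le_spectralRadius (isHermitian_sub_avgMatrix hW.symm) _

theorem dI_sq (hn : 0 < n) : dI n ^ 2 = n - 1 := by
  have h0 : (n : ℝ) ≠ 0 := by positivity
  unfold dI matNorm
  rw [Real.sq_sqrt (Finset.sum_nonneg fun _ _ => Finset.sum_nonneg fun _ _ => sq_nonneg _)]
  have h : ∀ i j : Fin n, (1 - avgMatrix n) i j ^ 2
      = (if i = j then 1 - 2 / (n : ℝ) else 0) + 1 / (n : ℝ) ^ 2 := by
    intro i j
    by_cases hij : i = j
    · subst hij
      simp [avgMatrix]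
      field_simp
      ring
    · simp [avgMatrix, hij, Matrix.one_apply_ne hij]
  simp only [h, Finset.sum_add_distrib, Finset.sum_ite_eq', Finset.mem_univ, if_true]
  simp
  field_simp
  ring

/-- Perturbing a contracted stack of vectors: Young's inequality with the parameter that turns the
factor `ρ²` into the midpoint of `ρ²` and `1`. -/
theorem nsq_add_le_of_contraction {ρ X : ℝ} (hρ : 0 ≤ ρ) (h1 : ρ ^ 2 < 1) (a b : Fin n → Vec r)
    (ha : nsq a ≤ ρ ^ 2 * X) (hX : 0 ≤ X) :
    nsq (a + b) ≤ (1 + ρ ^ 2) / 2 * X + (1 + ρ ^ 2) / (1 - ρ ^ 2) * nsq b := by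
  -- The Young parameter `(1 - ρ²) / (2ρ²)` needs `ρ ≠ 0`; if `ρ = 0`, then `a = 0`.
  rcases hρ.eq_or_lt with h0 | h0
  · subst h0
    have : nsq a = 0 := le_antisymm (by simpa using ha) (nsq_nonneg a)
    rw [nsq_eq_zero_iff] at this
    subst this
    simp only [zero_add]
    norm_num
    linarith
  · have hd : 0 < 1 - ρ ^ 2 := by linarith
    have hc : 0 < (1 - ρ ^ 2) / (2 * ρ ^ 2) := by positivity
    have h := nsq_add_le hc a b
    have e1 : (1 + (1 - ρ ^ 2) / (2 * ρ ^ 2)) * (ρ ^ 2 * X) = (1 + ρ ^ 2) / 2 * X := by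
      field_simp
      ring
    have e2 : 1 + 1 / ((1 - ρ ^ 2) / (2 * ρ ^ 2)) = (1 + ρ ^ 2) / (1 - ρ ^ 2) := by
      field_simp
      ring
    rw [e2] at h
    have h3 : (1 + (1 - ρ ^ 2) / (2 * ρ ^ 2)) * nsq a
        ≤ (1 + (1 - ρ ^ 2) / (2 * ρ ^ 2)) * (ρ ^ 2 * X) :=
      mul_le_mul_of_nonneg_left ha (by positivity)
    linarith

theorem rhoW_nonneg (W : Matrix (Fin n) (Fin n) ℝ) : 0 ≤ rhoW W := ENNReal.toReal_nonneg

end LinearAlgebra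

/-! ### Consequences of smoothness and strong convexity for the averaged objective. -/

/-- The stack of the local gradients, each at the local point. -/
noncomputable def gradStack {n r : ℕ} (f : Fin n → Vec r → ℝ) (x : Fin n → Vec r) :
    Fin n → Vec r := fun i => gradient (f i) (x i)

/-- The gradient of the global objective. -/
noncomputable def globalGrad {n r : ℕ} (f : Fin n → Vec r → ℝ) (x : Vec r) : Vec r :=
  agentAvg (gradStack f fun _ => x)

section Objective

variable {n r : ℕ}

theorem hasDerivAt_line {g : Vec r → ℝ} (hg : Differentiable ℝ g) (x v : Vec r) (t : ℝ) :
    HasDerivAt (fun t : ℝ => g (x + t • v)) (inner ℝ (gradient g (x + t • v)) v) t := by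
  have h1 : HasDerivAt (fun t : ℝ => x + t • v) v t := by
    simpa using ((hasDerivAt_id t).smul_const v).const_add x
  have h2 := (hg (x + t • v)).hasFDerivAt.comp_hasDerivAt t h1
  rwa [← inner_gradient_left] at h2

/-- The mean value theorem on `[0, 1]`, applied to `g` along the segment minus its quadratic upper
model: the derivative at the intermediate point is nonpositive. The sign of `c` is left free so that
the lower bound follows by passing to `-g` and `-c`. -/
theorem le_quadratic_of_inner_gradient_le {g : Vec r → ℝ} (hg : Differentiable ℝ g) {c : ℝ}
    (h : ∀ x x', inner ℝ (gradient g x - gradient g x') (x - x') ≤ c * ‖x - x'‖ ^ 2)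
    (x v : Vec r) : g (x + v) ≤ g x + inner ℝ (gradient g x) v + c / 2 * ‖v‖ ^ 2 := by
  have hd : ∀ t : ℝ, HasDerivAt
      (fun t : ℝ => g (x + t • v) - t * inner ℝ (gradient g x) v - c / 2 * ‖v‖ ^ 2 * t ^ 2)
      (inner ℝ (gradient g (x + t • v)) v - 1 * inner ℝ (gradient g x) v
        - c / 2 * ‖v‖ ^ 2 * (2 * t)) t := fun t => by
    refine ((hasDerivAt_line hg x v t).sub ((hasDerivAt_id t).mul_const _)).sub ?_
    simpa using (hasDerivAt_pow 2 t).const_mul (c / 2 * ‖v‖ ^ 2)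
  obtain ⟨t, ht, hs⟩ := exists_hasDerivAt_eq_slope _ _ (zero_lt_one' ℝ)
    (fun t _ => (hd t).continuousAt.continuousWithinAt) (fun t _ => hd t)
  have ht0 : 0 < t := ht.1
  have hi := h (x + t • v) x
  rw [add_sub_cancel_left, real_inner_smul_right, inner_sub_left, norm_smul, mul_pow,
    Real.norm_eq_abs, sq_abs] at hi
  have h2 : inner ℝ (gradient g (x + t • v)) v - inner ℝ (gradient g x) v ≤ c * ‖v‖ ^ 2 * t := by
    refine le_of_mul_le_mul_left ?_ ht0
    linarith
  simp only [one_smul, zero_smul, add_zero, one_mul, one_pow, sub_zero, div_one, mul_one, zero_mul,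
    zero_pow two_ne_zero, mul_zero] at hs
  linarith

theorem quadratic_le_of_le_inner_gradient {g : Vec r → ℝ} (hg : Differentiable ℝ g) {c : ℝ}
    (h : ∀ x x', c * ‖x - x'‖ ^ 2 ≤ inner ℝ (gradient g x - gradient g x') (x - x'))
    (x v : Vec r) : g x + inner ℝ (gradient g x) v + c / 2 * ‖v‖ ^ 2 ≤ g (x + v) := by
  have hgrad : ∀ x, gradient (-g) x = -gradient g x := fun x => by
    have : HasGradientAt (-g) (-gradient g x) x := by
      rw [hasGradientAt_iff_hasFDerivAt, map_neg]
      exact (hg x).hasGradientAt.hasFDerivAt.neg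
    exact this.gradient
  have := le_quadratic_of_inner_gradient_le (g := -g) (c := -c) hg.neg (fun x x' => by
    rw [hgrad, hgrad, ← neg_sub', inner_neg_left]
    linarith [h x x']) x v
  rw [hgrad, inner_neg_left] at this
  simp only [Pi.neg_apply] at this
  linarith

variable {f : Fin n → Vec r → ℝ} {μ L : ℝ}

theorem inner_agentAvg_left (z : Fin n → Vec r) (v : Vec r) :
    inner ℝ (agentAvg z) v = (1 / (n : ℝ)) * ∑ i, inner ℝ (z i) v := by
  simp [agentAvg, real_inner_smul_left, sum_inner]

theorem average_mono (a b : Fin n → ℝ) (h : ∀ i, a i ≤ b i) :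
    (1 / (n : ℝ)) * ∑ i, a i ≤ (1 / (n : ℝ)) * ∑ i, b i :=
  mul_le_mul_of_nonneg_left (Finset.sum_le_sum fun i _ => h i) (by positivity)

theorem average_const (hn : 0 < n) (c : ℝ) : (1 / (n : ℝ)) * ∑ _i : Fin n, c = c := by
  have : (n : ℝ) ≠ 0 := by positivity
  simp [this]

theorem globalObj_le_quadratic (hn : 0 < n) (hf : ObjectiveAssumption f μ L) (x v : Vec r) :
    globalObj f (x + v) ≤ globalObj f x + inner ℝ (globalGrad f x) v + L / 2 * ‖v‖ ^ 2 := by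
  have h := average_mono _ _ fun i => le_quadratic_of_inner_gradient_le (hf.differentiable i)
    (c := L) (fun x x' => by
      have h1 := real_inner_le_norm (gradient (f i) x - gradient (f i) x') (x - x')
      have h2 := mul_le_mul_of_nonneg_right (hf.lipschitz i x x') (norm_nonneg (x - x'))
      linarith) x v
  rw [Finset.sum_add_distrib, Finset.sum_add_distrib, mul_add, mul_add, average_const hn] at h
  rw [globalGrad, inner_agentAvg_left]
  exact h

theorem quadratic_le_globalObj (hn : 0 < n) (hf : ObjectiveAssumption f μ L) (x v : Vec r) :
    globalObj f x + inner ℝ (globalGrad f x) v + μ / 2 * ‖v‖ ^ 2 ≤ globalObj f (x + v) := by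
  have h := average_mono _ _ fun i => quadratic_le_of_le_inner_gradient (hf.differentiable i)
    (hf.strong i) x v
  rw [Finset.sum_add_distrib, Finset.sum_add_distrib, mul_add, mul_add, average_const hn] at h
  rw [globalGrad, inner_agentAvg_left]
  exact h

theorem nsq_gradStack_sub_le (hf : ObjectiveAssumption f μ L) (x x' : Fin n → Vec r) :
    nsq (gradStack f x - gradStack f x') ≤ L ^ 2 * nsq (x - x') := by
  unfold nsq
  rw [Finset.mul_sum]
  refine Finset.sum_le_sum fun i _ => ?_
  rw [← mul_pow]
  exact pow_le_pow_left₀ (norm_nonneg _) (hf.lipschitz i _ _) 2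

theorem nsq_const (v : Vec r) : nsq (fun _ : Fin n => v) = n * ‖v‖ ^ 2 := by simp [nsq]

theorem norm_globalGrad_sub_sq_le (hn : 0 < n) (hf : ObjectiveAssumption f μ L) (x x' : Vec r) :
    ‖globalGrad f x - globalGrad f x'‖ ^ 2 ≤ L ^ 2 * ‖x - x'‖ ^ 2 := by
  have hn' : (0 : ℝ) < n := by positivity
  have h1 := norm_agentAvg_sq_le hn (gradStack f (fun _ => x) - gradStack f fun _ => x')
  have h2 := nsq_gradStack_sub_le hf (fun _ : Fin n => x) fun _ => x'
  have h3 : nsq ((fun _ : Fin n => x) - fun _ => x') = n * ‖x - x'‖ ^ 2 := nsq_const _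
  rw [agentAvg_sub] at h1
  rw [h3] at h2
  refine le_of_mul_le_mul_left (a := (n : ℝ)) ?_ hn'
  calc _ ≤ _ := h1
    _ ≤ _ := h2
    _ = _ := by ring

/-- The averaged local gradients and the gradient at the average differ by the consensus error. -/
theorem norm_globalGrad_agentAvg_sub_sq_le (hn : 0 < n) (hf : ObjectiveAssumption f μ L)
    (x : Fin n → Vec r) :
    n * ‖agentAvg (gradStack f x) - globalGrad f (agentAvg x)‖ ^ 2 ≤ L ^ 2 * consensusSq x := by
  have h1 := norm_agentAvg_sq_le hn (gradStack f x - gradStack f fun _ => agentAvg x)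
  have h2 := nsq_gradStack_sub_le hf x fun _ : Fin n => agentAvg x
  rw [agentAvg_sub] at h1
  exact h1.trans h2

/-- A gradient step of length `1 / L` from the minimizer would lower the objective by `‖∇f‖² /
(2L)`. -/
theorem globalGrad_eq_zero (hn : 0 < n) (hf : ObjectiveAssumption f μ L) {xstar : Vec r}
    (hx : ∀ x, globalObj f xstar ≤ globalObj f x) : globalGrad f xstar = 0 := by
  have hL := hf.L_pos
  have h := globalObj_le_quadratic hn hf xstar (-(1 / L) • globalGrad f xstar)
  have h2 := hx (xstar + -(1 / L) • globalGrad f xstar)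
  rw [real_inner_smul_right, real_inner_self_eq_norm_sq, norm_smul, mul_pow] at h
  have h3 : L / 2 * (‖-(1 / L)‖ ^ 2 * ‖globalGrad f xstar‖ ^ 2)
      = 1 / (2 * L) * ‖globalGrad f xstar‖ ^ 2 := by
    rw [Real.norm_eq_abs, sq_abs]
    field_simp
  rw [h3] at h
  have h4 : 1 / (2 * L) * ‖globalGrad f xstar‖ ^ 2 ≤ 0 := by
    have : 1 / L = 2 * (1 / (2 * L)) := by field_simp
    rw [this] at h h2
    linarith
  have h5 : ‖globalGrad f xstar‖ ^ 2 ≤ 0 := by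
    by_contra hc
    push Not at hc
    have : 0 < 1 / (2 * L) * ‖globalGrad f xstar‖ ^ 2 := by positivity
    linarith
  have h6 : ‖globalGrad f xstar‖ = 0 := by nlinarith [norm_nonneg (globalGrad f xstar)]
  exact norm_eq_zero.1 h6

theorem gap_ge_sq (hn : 0 < n) (hf : ObjectiveAssumption f μ L) {xstar : Vec r}
    (hx : ∀ x, globalObj f xstar ≤ globalObj f x) (x : Vec r) :
    μ / 2 * ‖x - xstar‖ ^ 2 ≤ globalObj f x - globalObj f xstar := by
  have h := quadratic_le_globalObj hn hf xstar (x - xstar)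
  rw [globalGrad_eq_zero hn hf hx, inner_zero_left, add_sub_cancel] at h
  linarith

/-- The Polyak–Łojasiewicz inequality, `2μ (f - f*) ≤ ‖∇f‖²`. -/
theorem gap_le_norm_grad_sq (hn : 0 < n) (hf : ObjectiveAssumption f μ L) (xstar x : Vec r) :
    2 * μ * (globalObj f x - globalObj f xstar) ≤ ‖globalGrad f x‖ ^ 2 := by
  have hμ := hf.mu_pos
  have h := quadratic_le_globalObj hn hf x (xstar - x)
  rw [add_sub_cancel] at h
  have h2 : 0 ≤ ‖globalGrad f x + μ • (xstar - x)‖ ^ 2 := sq_nonneg _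
  rw [norm_add_sq_real, real_inner_smul_right, norm_smul, mul_pow, Real.norm_eq_abs,
    sq_abs] at h2
  nlinarith

theorem norm_grad_sq_le_gap (hn : 0 < n) (hf : ObjectiveAssumption f μ L) {xstar : Vec r}
    (hx : ∀ x, globalObj f xstar ≤ globalObj f x) (x : Vec r) :
    μ * ‖globalGrad f x‖ ^ 2 ≤ 2 * L ^ 2 * (globalObj f x - globalObj f xstar) := by
  have h := norm_globalGrad_sub_sq_le hn hf x xstar
  rw [globalGrad_eq_zero hn hf hx, sub_zero] at h
  have h2 := gap_ge_sq hn hf hx x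
  have := mul_le_mul_of_nonneg_left h hf.mu_pos.le
  have := mul_le_mul_of_nonneg_left h2 (sq_nonneg L)
  linarith

/-- A nonzero vector is required: in dimension zero both constants are arbitrary. -/
theorem mu_le_L (hn : 0 < n) (hf : ObjectiveAssumption f μ L) {v : Vec r} (hv : v ≠ 0) :
    μ ≤ L := by
  have h1 := hf.strong ⟨0, hn⟩ v 0
  have h2 := hf.lipschitz ⟨0, hn⟩ v 0
  have h3 := real_inner_le_norm
    (gradient (f ⟨0, hn⟩) v - gradient (f ⟨0, hn⟩) 0) (v - 0)
  rw [sub_zero] at h1 h2 h3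
  have hv' : 0 < ‖v‖ := norm_pos_iff.2 hv
  have h4 := mul_le_mul_of_nonneg_right h2 hv'.le
  refine le_of_mul_le_mul_right (a := ‖v‖ ^ 2) ?_ (by positivity)
  linarith

end Objective

/-! ### Geometric decay of the noiseless iteration. -/

/-- The decision variables after a noiseless iteration. -/
noncomputable def xNext {n r : ℕ} (W : Matrix (Fin n) (Fin n) ℝ) (α : ℝ) (x z : Fin n → Vec r) :
    Fin n → Vec r := mix W x - α • z

/-- The gradient trackers after an iteration that leads to the decision variables `x'`. -/
noncomputable def zNext {n r : ℕ} (W : Matrix (Fin n) (Fin n) ℝ) (f : Fin n → Vec r → ℝ) (γ : ℝ)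
    (x x' z : Fin n → Vec r) : Fin n → Vec r :=
  mix W z + γ • (gradStack f x' - gradStack f x)

/-- The Lyapunov function: optimality gap plus consensus errors. -/
noncomputable def lyapunov {n r : ℕ} (A c : ℝ) (f : Fin n → Vec r → ℝ) (xstar : Vec r)
    (x z : Fin n → Vec r) : ℝ :=
  A * (n * (globalObj f (agentAvg x) - globalObj f xstar)) + consensusSq x + c * consensusSq z

section Contraction

variable {n r : ℕ} {W : Matrix (Fin n) (Fin n) ℝ} {f : Fin n → Vec r → ℝ} {μ L : ℝ}

theorem agentAvg_xNext (hW : NetworkAssumption W) {α γ : ℝ} {x z : Fin n → Vec r}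
    (hz : agentAvg z = γ • agentAvg (gradStack f x)) :
    agentAvg (xNext W α x z) = agentAvg x + -(α * γ) • agentAvg (gradStack f x) := by
  rw [xNext, agentAvg_sub, agentAvg_mix hW.col_sum, agentAvg_smul, hz, smul_smul, neg_smul,
    sub_eq_add_neg]

/-- The average moves along `q`, the mean of the local gradients, instead of `D`, the gradient at
the average. In the descent lemma, `2⟨D, q⟩ = ‖D‖² + ‖q‖² - ‖q - D‖²`, and the last square is
controlled by the consensus error. The `‖q‖²` term is kept, since it must pay for the drift of the
trackers. -/
theorem gap_xNext_le (hn : 0 < n) (hW : NetworkAssumption W) (hf : ObjectiveAssumption f μ L)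
    (xstar : Vec r) {α γ : ℝ} (hα : 0 < α) (hγ : 0 < γ) {x z : Fin n → Vec r}
    (hz : agentAvg z = γ • agentAvg (gradStack f x)) :
    n * (globalObj f (agentAvg (xNext W α x z)) - globalObj f xstar)
      ≤ n * (globalObj f (agentAvg x) - globalObj f xstar)
        - α * γ / 2 * (n * ‖globalGrad f (agentAvg x)‖ ^ 2)
        - α * γ / 2 * (1 - α * γ * L) * (n * ‖agentAvg (gradStack f x)‖ ^ 2)
        + α * γ / 2 * (L ^ 2 * consensusSq x) := by
  set q := agentAvg (gradStack f x) with hq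
  set D := globalGrad f (agentAvg x) with hD
  have h1 := globalObj_le_quadratic hn hf (agentAvg x) (-(α * γ) • q)
  rw [← agentAvg_xNext hW hz, real_inner_smul_right, norm_smul, mul_pow, Real.norm_eq_abs,
    sq_abs, ← hD] at h1
  have h2 : n * ‖q - D‖ ^ 2 ≤ L ^ 2 * consensusSq x := norm_globalGrad_agentAvg_sub_sq_le hn hf x
  rw [norm_sub_sq_real, real_inner_comm] at h2
  have h3 := mul_le_mul_of_nonneg_left h1 (Nat.cast_nonneg (α := ℝ) n)
  have h4 := mul_le_mul_of_nonneg_left h2 (by positivity : 0 ≤ α * γ / 2)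
  linarith

theorem consensusSq_xNext_le (hn : 0 < n) (hW : NetworkAssumption W) (hρ : rhoW W ^ 2 < 1)
    (α : ℝ) (x z : Fin n → Vec r) :
    consensusSq (xNext W α x z) ≤ (1 + rhoW W ^ 2) / 2 * consensusSq x
      + (1 + rhoW W ^ 2) / (1 - rhoW W ^ 2) * (α ^ 2 * consensusSq z) := by
  have h := nsq_add_le_of_contraction (rhoW_nonneg W) hρ (dev (mix W x)) ((-α) • dev z)
    (consensusSq_mix_le hW hn x) (consensusSq_nonneg x)
  rw [nsq_smul, neg_sq] at h
  rw [consensusSq_eq_nsq_dev, xNext, dev_sub, dev_smul]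
  rwa [neg_smul, ← sub_eq_add_neg] at h

theorem nsq_mix_sub_self_le (hn : 0 < n) (hW : NetworkAssumption W) (hρ : rhoW W ^ 2 < 1)
    (x : Fin n → Vec r) : nsq (mix W x - x) ≤ 4 * consensusSq x := by
  have h1 : mix W x - x = dev (mix W x) - dev x := by
    funext i
    simp [dev, agentAvg_mix hW.col_sum]
  rw [h1]
  have h2 := nsq_sub_le_two (dev (mix W x)) (dev x)
  have h3 := consensusSq_mix_le hW hn x
  have h4 : rhoW W ^ 2 * consensusSq x ≤ 1 * consensusSq x :=
    mul_le_mul_of_nonneg_right hρ.le (consensusSq_nonneg x)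
  rw [← consensusSq_eq_nsq_dev x] at h2
  linarith

/-- The trackers are disturbed by the change of the gradients, at most `L ‖x' - x‖`. Here `x' - x =
(W - I) x - α z`, where `(W - I) x` sees only the deviations of `x`, and `z` splits into its
deviations and its average `γ q`. -/
theorem consensusSq_zNext_le (hn : 0 < n) (hW : NetworkAssumption W) (hρ : rhoW W ^ 2 < 1)
    (hf : ObjectiveAssumption f μ L) {α γ : ℝ} {x z : Fin n → Vec r}
    (hz : agentAvg z = γ • agentAvg (gradStack f x)) :
    consensusSq (zNext W f γ x (xNext W α x z) z) ≤ (1 + rhoW W ^ 2) / 2 * consensusSq z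
      + (1 + rhoW W ^ 2) / (1 - rhoW W ^ 2) * (γ ^ 2 * (L ^ 2 * (8 * consensusSq x
        + 2 * (α ^ 2 * consensusSq z)
        + 2 * ((α * γ) ^ 2 * (n * ‖agentAvg (gradStack f x)‖ ^ 2))))) := by
  have hd : 0 < 1 - rhoW W ^ 2 := by linarith
  have h := nsq_add_le_of_contraction (rhoW_nonneg W) hρ (dev (mix W z))
    (γ • dev (gradStack f (xNext W α x z) - gradStack f x))
    (consensusSq_mix_le hW hn z) (consensusSq_nonneg z)
  rw [← dev_smul, ← dev_add, dev_smul, nsq_smul, ← consensusSq_eq_nsq_dev,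
    ← consensusSq_eq_nsq_dev] at h
  refine h.trans (add_le_add_right ?_ _)
  refine mul_le_mul_of_nonneg_left (mul_le_mul_of_nonneg_left ?_ (sq_nonneg _)) (by positivity)
  refine (consensusSq_le_nsq hn _).trans ((nsq_gradStack_sub_le hf _ _).trans
    (mul_le_mul_of_nonneg_left ?_ (sq_nonneg _)))
  have h1 : xNext W α x z - x = (mix W x - x) - α • z := by
    rw [xNext]
    abel
  have h2 := nsq_sub_le_two (mix W x - x) (α • z)
  have h3 := nsq_mix_sub_self_le hn hW hρ x
  rw [nsq_smul, nsq_eq_consensusSq_add hn z, hz, norm_smul, mul_pow, Real.norm_eq_abs, sq_abs]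
    at h2
  rw [h1]
  linarith

/-- The arithmetic of the contraction for `n > 1`. Here `δ = 1 - ρ²`, `h = αγ`, `N` is `n` times the
gap, `X` and `v` are the consensus errors of `x` and `α z`, and `G`, `E` are `n` times the squared
norms of the mean local gradient and of the gradient at the average. -/
theorem lyapunov_step_scalar {δ h L μ N N' X X' v v' G E : ℝ} (hδ : 0 < δ) (hδ1 : δ ≤ 1)
    (hh : 0 < h) (hL : 0 < L) (ht : 128 * (2 - δ) * (h * L) ^ 2 ≤ δ ^ 4)
    (hN : 0 ≤ N) (hX : 0 ≤ X) (hv : 0 ≤ v) (hG : 0 ≤ G) (hE : 2 * μ * N ≤ E)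
    (hN' : N' ≤ N - h / 2 * E - h / 2 * (1 - h * L) * G + h / 2 * (L ^ 2 * X))
    (hX' : X' ≤ (2 - δ) / 2 * X + (2 - δ) / δ * v)
    (hv' : v' ≤ (2 - δ) / 2 * v + (2 - δ) / δ * ((h * L) ^ 2 * (8 * X + 2 * v + 2 * (h ^ 2 * G))))
    {κ : ℝ} (hκ1 : κ ≤ h * μ) (hκ2 : κ ≤ δ / 25) :
    δ / (5 * h * L ^ 2) * N' + X' + 5 / 2 * (2 - δ) / δ ^ 2 * v'
      ≤ (1 - κ) * (δ / (5 * h * L ^ 2) * N + X + 5 / 2 * (2 - δ) / δ ^ 2 * v) := by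
  set s := 2 - δ with hs
  have hs1 : 1 ≤ s := by linarith
  have hs2 : s ≤ 2 := by linarith
  -- `A` is chosen so that the gap charges only `δ / 10` to the coefficient of `X`, whose
  -- contraction gains `δ / 2`. `c` is chosen so that the contraction of `v` gains `5/4 * (s / δ)`,
  -- more than the `s / δ` that `v` feeds into `X'`.
  set A := δ / (5 * h * L ^ 2) with hA
  set c := 5 / 2 * s / δ ^ 2 with hc
  have hA0 : 0 < A := by positivity
  have hc0 : 0 < c := by positivity
  set t := h * L with htdef
  have ht0 : 0 < t := by positivity
  have hδ4 : δ ^ 4 ≤ 1 := pow_le_one₀ hδ.le hδ1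
  have ht2 : t ^ 2 ≤ 1 / 128 := by nlinarith [sq_nonneg t]
  have ht1 : t ≤ 1 / 10 := by nlinarith
  have hP : c * (s / δ * t ^ 2) ≤ 5 / 256 * (s * δ) := by
    have : c * (s / δ * t ^ 2) = 5 / 256 * s / δ ^ 3 * (128 * s * t ^ 2) := by
      rw [hc]
      field_simp
      ring
    rw [this]
    calc 5 / 256 * s / δ ^ 3 * (128 * s * t ^ 2) ≤ 5 / 256 * s / δ ^ 3 * δ ^ 4 :=
          mul_le_mul_of_nonneg_left ht (by positivity)
      _ = _ := by
          field_simp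
  have hAh : A * (h / 2 * (L ^ 2 * X)) = δ / 10 * X := by
    rw [hA]
    field_simp
    ring
  have hAG : A * (h / 2 * (1 - t) * G) = δ / 10 * (1 - t) * (G / L ^ 2) := by
    rw [hA]
    field_simp
    ring
  have hhG : h ^ 2 * G = t ^ 2 * (G / L ^ 2) := by
    rw [htdef]
    field_simp
  have hcs : c * (s / 2 * v) = c * v - 5 / 4 * (s / δ * v) := by
    rw [hc, hs]
    field_simp
    ring
  have hcv : c * v = 5 / 2 / δ * (s / δ * v) := by
    rw [hc]
    field_simp
  set u := s / δ * v with hu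
  have hu0 : 0 ≤ u := by positivity
  have hsv : s * δ * v ≤ u := by
    have : s * δ * v = δ ^ 2 * u := by
      rw [hu]
      field_simp
    rw [this]
    have : δ ^ 2 ≤ 1 := pow_le_one₀ hδ.le hδ1
    nlinarith
  set g := G / L ^ 2 with hg
  have hg0 : 0 ≤ g := by positivity
  have hB : 0 ≤ 8 * X + 2 * v + 2 * (h ^ 2 * G) := by positivity
  have e1 : c * v' ≤ c * v - 5 / 4 * u
      + 5 / 256 * (s * δ) * (8 * X + 2 * v + 2 * (h ^ 2 * G)) := by
    have h1 := mul_le_mul_of_nonneg_left hv' hc0.le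
    rw [mul_add, hcs] at h1
    have h2 := mul_le_mul_of_nonneg_right hP hB
    linarith
  have e2 : A * N' ≤ A * N - h / 2 * (A * E) - δ / 10 * (1 - t) * g + δ / 10 * X := by
    have h1 := mul_le_mul_of_nonneg_left hN' hA0.le
    linarith
  have e3 : A * (2 * μ * N) ≤ A * E := mul_le_mul_of_nonneg_left hE hA0.le
  have e4 : h / 2 * (A * (2 * μ * N)) ≤ h / 2 * (A * E) :=
    mul_le_mul_of_nonneg_left e3 (by positivity)
  have e5 : s * δ * X ≤ 2 * (δ * X) := by
    have := mul_le_mul_of_nonneg_right hs2 (by positivity : 0 ≤ δ * X)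
    linarith
  have e6 : s * δ * (h ^ 2 * G) ≤ 2 * δ * (1 / 128 * g) := by
    rw [hhG]
    have h1 : s * δ ≤ 2 * δ := mul_le_mul_of_nonneg_right hs2 hδ.le
    have h2 : t ^ 2 * g ≤ 1 / 128 * g := mul_le_mul_of_nonneg_right ht2 hg0
    exact mul_le_mul h1 h2 (by positivity) (by positivity)
  have e7 : δ / 10 * (9 / 10) * g ≤ δ / 10 * (1 - t) * g := by
    refine mul_le_mul_of_nonneg_right (mul_le_mul_of_nonneg_left ?_ (by positivity)) hg0
    linarith
  have k1 : κ * (A * N) ≤ h * μ * (A * N) := mul_le_mul_of_nonneg_right hκ1 (by positivity)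
  have k2 : κ * X ≤ δ / 25 * X := mul_le_mul_of_nonneg_right hκ2 hX
  have k3 : κ * (c * v) ≤ 1 / 10 * u := by
    have h1 : κ * (c * v) ≤ δ / 25 * (c * v) := mul_le_mul_of_nonneg_right hκ2 (by positivity)
    have h2 : δ / 25 * (c * v) = 1 / 10 * u := by
      rw [hcv]
      field_simp
      ring
    linarith
  have hδX : 0 ≤ δ * X := by positivity
  have hδg : 0 ≤ δ * g := by positivity
  have hX'' : X' ≤ X - δ / 2 * X + u := by
    have : s / 2 * X = X - δ / 2 * X := by
      rw [hs]
      ring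
    linarith
  -- The margins left for `κ`: the coefficient of `X` gains at least `δ (1/2 - 1/10 - 5/16) > δ /
  -- 25`, that of `u` at least `5/4 - 1 - 5/128 > 1/10`, and the gap gains `h μ`. The terms in `g`
  -- have a negative total.
  linarith

/-- The spectral gap is read off the stepsize bound: a positive `αγ` lies below a quotient that
would be nonpositive if `ρ² ≥ 1`. -/
theorem rhoW_sq_lt_one_of_stepsize {α γ : ℝ} (h : StepsizeCondition W μ L α γ)
    (hn : 1 < n) (hL : 0 < L) (hα : 0 < α) (hγ : 0 < γ) : rhoW W ^ 2 < 1 := by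
  have h1 := (h.2 hn).1
  by_contra hc
  push Not at hc
  have h2 : (1 - rhoW W ^ 2) / (4 * Real.sqrt 2 * L * dI n) ≤ 0 :=
    div_nonpos_of_nonpos_of_nonneg (by linarith)
      (mul_nonneg (by positivity) (Real.sqrt_nonneg _))
  have : 0 < α * γ := by positivity
  linarith

/-- The square root in the third stepsize bound is at least `c42`, so `(αγ)² c42 ≤ 1`. Then `c42` is
bounded below using `d_I² = n - 1 ≥ 1` and `μ ≤ L`. -/
theorem mul_sq_le_of_stepsize {α γ : ℝ} (h : StepsizeCondition W μ L α γ)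
    (hn : 1 < n) (hμ : 0 < μ) (hL : 0 < L) (hμL : μ ≤ L) (hα : 0 < α) (hγ : 0 < γ) :
    128 * (1 + rhoW W ^ 2) * (α * γ * L) ^ 2 ≤ (1 - rhoW W ^ 2) ^ 4 := by
  have hρ := rhoW_sq_lt_one_of_stepsize h hn hL hα hγ
  have hδ : 0 < 1 - rhoW W ^ 2 := by linarith
  have hn' : (2 : ℝ) ≤ n := by exact_mod_cast hn
  have hd : 1 ≤ dI n ^ 2 := by
    rw [dI_sq (by omega)]
    linarith
  have hc : 0 < c42 W μ L := by
    unfold c42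
    positivity
  have hS : 0 ≤ Real.sqrt (c42 W μ L ^ 2 + 4 * c41 W μ L) := Real.sqrt_nonneg _
  set h0 := α * γ with hh0
  have hpos : 0 < h0 := by positivity
  have h1 : h0 ^ 2 < 2 / (c42 W μ L + Real.sqrt (c42 W μ L ^ 2 + 4 * c41 W μ L)) :=
    (Real.lt_sqrt hpos.le).1 (h.2 hn).2
  have hc41 : 0 ≤ c41 W μ L := by
    unfold c41
    positivity
  have hS2 : c42 W μ L ≤ Real.sqrt (c42 W μ L ^ 2 + 4 * c41 W μ L) :=
    Real.le_sqrt_of_sq_le (by linarith)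
  have h2 : h0 ^ 2 * c42 W μ L ≤ 1 := by
    rw [lt_div_iff₀ (by positivity)] at h1
    have := mul_le_mul_of_nonneg_left hS2 (sq_nonneg h0)
    linarith
  have h3 : 128 * (1 + rhoW W ^ 2) * L ^ 2 / (1 - rhoW W ^ 2) ^ 4 ≤ c42 W μ L := by
    unfold c42
    rw [div_le_div_iff₀ (by positivity) (by positivity)]
    have e1 : 2 * (μ + L) ^ 2 ≤ μ ^ 2 + 2 * μ * L + 5 * L ^ 2 := by
      have : 0 ≤ (3 * L + μ) * (L - μ) := mul_nonneg (by positivity) (by linarith)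
      linarith
    have e2 : 2 * (μ + L) ^ 2 ≤ (μ ^ 2 + 2 * μ * L + 5 * L ^ 2) * dI n ^ 2 := by
      have := mul_le_mul_of_nonneg_left hd
        (by positivity : 0 ≤ μ ^ 2 + 2 * μ * L + 5 * L ^ 2)
      linarith
    have e3 := mul_le_mul_of_nonneg_left e2
      (by positivity : 0 ≤ 64 * (1 + rhoW W ^ 2) * L ^ 2 * (1 - rhoW W ^ 2) ^ 4)
    linarith
  have h4 := mul_le_mul_of_nonneg_left h3 (sq_nonneg h0)
  have h5 : h0 ^ 2 * (128 * (1 + rhoW W ^ 2) * L ^ 2 / (1 - rhoW W ^ 2) ^ 4)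
      = 128 * (1 + rhoW W ^ 2) * (h0 * L) ^ 2 / (1 - rhoW W ^ 2) ^ 4 := by ring
  have h6 := (h4.trans h2)
  rw [h5, div_le_one (by positivity)] at h6
  exact h6

/-- Without noise, the Lyapunov function decreases geometrically. -/
theorem exists_lyapunov_contraction (hn : 0 < n) (hW : NetworkAssumption W)
    (hf : ObjectiveAssumption f μ L) {xstar : Vec r}
    (hx : ∀ x, globalObj f xstar ≤ globalObj f x) {α γ : ℝ} (hα : 0 < α) (hγ : 0 < γ)
    (hstep : StepsizeCondition W μ L α γ) :
    ∃ A c lam : ℝ, 0 < A ∧ 0 < c ∧ 0 < lam ∧ lam < 1 ∧ ∀ x z : Fin n → Vec r,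
      agentAvg z = γ • agentAvg (gradStack f x) →
      lyapunov A c f xstar (xNext W α x z) (zNext W f γ x (xNext W α x z) z)
        ≤ lam * lyapunov A c f xstar x z := by
  have hμ := hf.mu_pos
  have hL := hf.L_pos
  -- For `r = 0` the Lyapunov function vanishes identically; this case is separate because `μ ≤ L`
  -- may fail.
  rcases subsingleton_or_nontrivial (Vec r) with hsub | hnt
  · refine ⟨1, 1, 1 / 2, one_pos, one_pos, by norm_num, by norm_num, fun x z _ => ?_⟩
    have h0 : ∀ x z : Fin n → Vec r, lyapunov 1 1 f xstar x z = 0 := fun x z => by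
      have e1 : ∀ w : Fin n → Vec r, consensusSq w = 0 := fun w => by
        simp [consensusSq, Subsingleton.elim _ (0 : Vec r)]
      rw [lyapunov, e1, e1, Subsingleton.elim (agentAvg x) xstar]
      simp
    rw [h0, h0, mul_zero]
  obtain ⟨v, hv⟩ := exists_ne (0 : Vec r)
  have hμL := mu_le_L hn hf hv
  have hh : 0 < α * γ := by positivity
  have hgap : ∀ x : Fin n → Vec r, 0 ≤ n * (globalObj f (agentAvg x) - globalObj f xstar) :=
    fun x => mul_nonneg (Nat.cast_nonneg _) (sub_nonneg.2 (hx _))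
  have hPL : ∀ x : Fin n → Vec r, 2 * μ * (n * (globalObj f (agentAvg x) - globalObj f xstar))
      ≤ n * ‖globalGrad f (agentAvg x)‖ ^ 2 := fun x => by
    have := mul_le_mul_of_nonneg_left (gap_le_norm_grad_sq hn hf xstar (agentAvg x))
      (Nat.cast_nonneg (α := ℝ) n)
    linarith
  rcases (Nat.succ_le_iff.2 hn).eq_or_lt with h1 | h1
  · obtain rfl : n = 1 := h1.symm
    have hh2 : α * γ * L < 2 := by
      have := hstep.1
      rw [lt_div_iff₀ (by positivity)] at this
      have : 0 < α * γ * μ := by positivity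
      linarith
    -- A single agent performs plain gradient descent: there is no consensus error and `q = D`, so
    -- `αγL < 2` suffices. The maximum with `1 / 2` only keeps the factor positive.
    refine ⟨1, 1, max (1 / 2) (1 - α * γ * μ * (2 - α * γ * L)), one_pos, one_pos, by positivity,
      ?_, fun x z hz => ?_⟩
    · have : 0 < α * γ * μ * (2 - α * γ * L) := mul_pos (by positivity) (by linarith)
      exact max_lt (by norm_num) (by linarith)
    simp only [lyapunov, consensusSq_of_card_one, mul_zero, add_zero, one_mul]
    refine le_trans ?_ (mul_le_mul_of_nonneg_right (le_max_right _ _) (hgap x))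
    have e1 := gap_xNext_le hn hW hf xstar hα hγ hz
    have e2 : agentAvg (gradStack f x) = globalGrad f (agentAvg x) := by
      have : x = fun _ => agentAvg x := by
        funext i
        rw [Subsingleton.elim i 0]
        simp [agentAvg]
      rw [globalGrad, ← this]
    rw [e2, consensusSq_of_card_one] at e1
    have e3 := mul_le_mul_of_nonneg_left (hPL x)
      (mul_nonneg (by positivity : 0 ≤ α * γ / 2) (by linarith : 0 ≤ 2 - α * γ * L))
    simp only [Nat.cast_one, one_mul] at e1 e3 ⊢
    linarith
  · have h1 : 1 < n := h1
    have hρ := rhoW_sq_lt_one_of_stepsize hstep h1 hL hα hγ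
    have ht := mul_sq_le_of_stepsize hstep h1 hμ hL hμL hα hγ
    have hδ : 0 < 1 - rhoW W ^ 2 := by linarith
    have hδ1 : 1 - rhoW W ^ 2 ≤ 1 := by linarith [sq_nonneg (rhoW W)]
    set δ := 1 - rhoW W ^ 2 with hδdef
    have hs : 1 + rhoW W ^ 2 = 2 - δ := by
      rw [hδdef]
      ring
    have h2δ : 0 < 2 - δ := by linarith
    refine ⟨δ / (5 * (α * γ) * L ^ 2), 5 / 2 * (2 - δ) / δ ^ 2 * α ^ 2,
      1 - min (α * γ * μ) (δ / 25), by positivity, by positivity, ?_, ?_, fun x z hz => ?_⟩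
    · have := min_le_right (α * γ * μ) (δ / 25)
      linarith
    · have : 0 < min (α * γ * μ) (δ / 25) := lt_min (by positivity) (by positivity)
      linarith
    have e1 := gap_xNext_le hn hW hf xstar hα hγ hz
    have e2 := consensusSq_xNext_le hn hW hρ α x z
    have e3 := mul_le_mul_of_nonneg_left (consensusSq_zNext_le (α := α) hn hW hρ hf hz)
      (sq_nonneg α)
    rw [hs] at e2 e3 ht
    rw [← hδdef] at e2 e3
    have := lyapunov_step_scalar hδ hδ1 hh hL ht (hgap x) (consensusSq_nonneg x)
      (mul_nonneg (sq_nonneg α) (consensusSq_nonneg z)) (by positivity) (hPL x) e1 e2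
      (e3.trans (le_of_eq (by ring))) (min_le_left _ (δ / 25)) (min_le_right (α * γ * μ) _)
    unfold lyapunov
    linarith

end Contraction

/-! ### Noise as a perturbation, and the pathwise bound. -/

/-- The weights of the messages received from other agents. -/
noncomputable def offDiag {n : ℕ} (W : Matrix (Fin n) (Fin n) ℝ) : Matrix (Fin n) (Fin n) ℝ :=
  W - Matrix.diagonal fun i => W i i

/-- The noise-free increment of the tracking variables. -/
noncomputable def tracker {n r : ℕ} (W : Matrix (Fin n) (Fin n) ℝ) (f : Fin n → Vec r → ℝ) (γ : ℝ)
    (s x : Fin n → Vec r) : Fin n → Vec r := mix W s - s + γ • gradStack f x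

section Perturbation

variable {n r : ℕ} {W : Matrix (Fin n) (Fin n) ℝ} {f : Fin n → Vec r → ℝ} {μ L : ℝ}

/-- The cross term `⟨∇f(v), u⟩` is split by Young's inequality, and `‖∇f‖²` is at most `2L² / μ`
times the gap. -/
theorem gap_add_le (hn : 0 < n) (hf : ObjectiveAssumption f μ L) {xstar : Vec r}
    (hx : ∀ x, globalObj f xstar ≤ globalObj f x) {ε : ℝ} (hε : 0 < ε) (v u : Vec r) :
    globalObj f (v + u) - globalObj f xstar ≤ (1 + ε) * (globalObj f v - globalObj f xstar)
      + (L / 2 + L ^ 2 / (2 * ε * μ)) * ‖u‖ ^ 2 := by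
  have hμ := hf.mu_pos
  have hL := hf.L_pos
  have h1 := globalObj_le_quadratic hn hf v u
  have h2 := real_inner_le_norm (globalGrad f v) u
  have h3 := norm_grad_sq_le_gap hn hf hx v
  set d := ‖globalGrad f v‖
  have h4 : d * ‖u‖ ≤ ε * μ / (2 * L ^ 2) * d ^ 2 + L ^ 2 / (2 * ε * μ) * ‖u‖ ^ 2 := by
    have : 0 ≤ (ε * μ * d - L ^ 2 * ‖u‖) ^ 2 / (2 * ε * μ * L ^ 2) := by positivity
    have e : (ε * μ * d - L ^ 2 * ‖u‖) ^ 2 / (2 * ε * μ * L ^ 2)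
        = ε * μ / (2 * L ^ 2) * d ^ 2 - d * ‖u‖ + L ^ 2 / (2 * ε * μ) * ‖u‖ ^ 2 := by
      field_simp
      ring
    linarith
  have h5 : ε * μ / (2 * L ^ 2) * d ^ 2 ≤ ε * (globalObj f v - globalObj f xstar) := by
    have e1 : ε * μ / (2 * L ^ 2) * d ^ 2 = ε / (2 * L ^ 2) * (μ * d ^ 2) := by ring
    have e2 : ε * (globalObj f v - globalObj f xstar)
        = ε / (2 * L ^ 2) * (2 * L ^ 2 * (globalObj f v - globalObj f xstar)) := by
      field_simp
    rw [e1, e2]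
    exact mul_le_mul_of_nonneg_left h3 (by positivity)
  linarith

theorem consensusSq_add_le (hn : 0 < n) {ε : ℝ} (hε : 0 < ε) (x u : Fin n → Vec r) :
    consensusSq (x + u) ≤ (1 + ε) * consensusSq x + (1 + 1 / ε) * nsq u := by
  have h := nsq_add_le hε (dev x) (dev u)
  rw [← dev_add] at h
  have h2 := mul_le_mul_of_nonneg_left (consensusSq_le_nsq hn u)
    (by positivity : 0 ≤ 1 + 1 / ε)
  simp only [consensusSq_eq_nsq_dev] at h2 ⊢
  linarith

theorem exists_lyapunov_add_le (hn : 0 < n) (hf : ObjectiveAssumption f μ L) {xstar : Vec r}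
    (hx : ∀ x, globalObj f xstar ≤ globalObj f x) {A c ε : ℝ} (hA : 0 < A) (hc : 0 < c)
    (hε : 0 < ε) :
    ∃ K : ℝ, 0 < K ∧ ∀ x z u v : Fin n → Vec r, lyapunov A c f xstar (x + u) (z + v)
      ≤ (1 + ε) * lyapunov A c f xstar x z + K * (nsq u + nsq v) := by
  have hμ := hf.mu_pos
  have hL := hf.L_pos
  set B := L / 2 + L ^ 2 / (2 * ε * μ) with hB
  have hB0 : 0 < B := by positivity
  refine ⟨A * B + (1 + 1 / ε) + c * (1 + 1 / ε), by positivity, fun x z u v => ?_⟩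
  have h1 := mul_le_mul_of_nonneg_left (gap_add_le hn hf hx hε (agentAvg x) (agentAvg u))
    (by positivity : 0 ≤ A * n)
  rw [← agentAvg_add, ← hB] at h1
  have h2 := mul_le_mul_of_nonneg_left (norm_agentAvg_sq_le hn u) (by positivity : 0 ≤ A * B)
  have h3 := consensusSq_add_le hn hε x u
  have h4 := mul_le_mul_of_nonneg_left (consensusSq_add_le hn hε z v) hc.le
  have h5 : 0 ≤ (1 + 1 / ε) * nsq v := mul_nonneg (by positivity) (nsq_nonneg v)
  have h6 : 0 ≤ c * (1 + 1 / ε) * nsq u := mul_nonneg (by positivity) (nsq_nonneg u)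
  have h7 : 0 ≤ A * B * nsq v := mul_nonneg (by positivity) (nsq_nonneg v)
  unfold lyapunov
  linarith

theorem lyapunov_nonneg {xstar : Vec r} (hx : ∀ x, globalObj f xstar ≤ globalObj f x) {A c : ℝ}
    (hA : 0 < A) (hc : 0 < c) (x z : Fin n → Vec r) : 0 ≤ lyapunov A c f xstar x z := by
  have h1 : 0 ≤ globalObj f (agentAvg x) - globalObj f xstar := sub_nonneg.2 (hx _)
  have h2 := consensusSq_nonneg x
  have h3 := consensusSq_nonneg z
  unfold lyapunov
  positivity

theorem exists_lyapunov_noisy_step (hn : 0 < n) (hW : NetworkAssumption W)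
    (hf : ObjectiveAssumption f μ L) {xstar : Vec r}
    (hx : ∀ x, globalObj f xstar ≤ globalObj f x) {α γ : ℝ} (hα : 0 < α) (hγ : 0 < γ)
    (hstep : StepsizeCondition W μ L α γ) :
    ∃ A c lam K : ℝ, 0 < A ∧ 0 < c ∧ 0 < lam ∧ lam < 1 ∧ 0 < K ∧ ∀ x z u v : Fin n → Vec r,
      agentAvg z = γ • agentAvg (gradStack f x) →
      lyapunov A c f xstar (xNext W α x z + u) (zNext W f γ x (xNext W α x z + u) z + v)
        ≤ lam * lyapunov A c f xstar x z + K * (nsq u + nsq v) := by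
  obtain ⟨A, c, lam, hA, hc, hl0, hl1, h⟩ :=
    exists_lyapunov_contraction hn hW hf hx hα hγ hstep
  -- With this Young parameter, `(1 + ε) lam` is the midpoint of `lam` and `1`.
  have hε : 0 < (1 - lam) / (2 * lam) := div_pos (by linarith) (by linarith)
  obtain ⟨K, hK, hp⟩ := exists_lyapunov_add_le hn hf hx hA hc hε
  have hlam : (1 + (1 - lam) / (2 * lam)) * lam = (1 + lam) / 2 := by
    field_simp
    ring
  refine ⟨A, c, (1 + lam) / 2, K * (2 + 2 * γ ^ 2 * L ^ 2), hA, hc, by linarith, by linarith,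
    by positivity, fun x z u v hz => ?_⟩
  set x' := xNext W α x z
  -- A perturbation `u` of the decision variables also moves the new gradients; this shift joins `v`
  -- and is Lipschitz in `u`.
  have e : zNext W f γ x (x' + u) z + v
      = zNext W f γ x x' z + (γ • (gradStack f (x' + u) - gradStack f x') + v) := by
    simp only [zNext, smul_sub]
    abel
  have h1 := hp x' (zNext W f γ x x' z) u (γ • (gradStack f (x' + u) - gradStack f x') + v)
  have h2 := mul_le_mul_of_nonneg_left (h x z hz)
    (by linarith : 0 ≤ 1 + (1 - lam) / (2 * lam))
  have h3 := nsq_add_le_two (γ • (gradStack f (x' + u) - gradStack f x')) v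
  have h4 := mul_le_mul_of_nonneg_left (nsq_gradStack_sub_le hf (x' + u) x') (sq_nonneg γ)
  rw [add_sub_cancel_left] at h4
  rw [nsq_smul] at h3
  have h5 : nsq u + nsq (γ • (gradStack f (x' + u) - gradStack f x') + v)
      ≤ (2 + 2 * γ ^ 2 * L ^ 2) * (nsq u + nsq v) := by
    have : 0 ≤ 2 * γ ^ 2 * L ^ 2 * nsq v := mul_nonneg (by positivity) (nsq_nonneg v)
    linarith [nsq_nonneg u]
  have h6 := mul_le_mul_of_nonneg_left h5 hK.le
  rw [← mul_assoc, hlam] at h2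
  rw [e]
  linarith

theorem sum_erase_smul (W : Matrix (Fin n) (Fin n) ℝ) (s e : Fin n → Vec r) (b : ℝ) (i : Fin n) :
    W i i • s i + ∑ j ∈ Finset.univ.erase i, W i j • (s j + b • e j)
      = mix W s i + b • mix (offDiag W) e i := by
  have h1 : mix (offDiag W) e i = ∑ j ∈ Finset.univ.erase i, W i j • e j := by
    rw [mix, ← Finset.add_sum_erase _ _ (Finset.mem_univ i)]
    simp only [offDiag, Matrix.sub_apply, Matrix.diagonal_apply_eq, sub_self, zero_smul, zero_add]
    refine Finset.sum_congr rfl fun j hj => ?_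
    rw [Matrix.diagonal_apply_ne _ (Finset.ne_of_mem_erase hj).symm, sub_zero]
  rw [h1, mix, ← Finset.add_sum_erase _ _ (Finset.mem_univ i)]
  simp only [smul_add, Finset.sum_add_distrib, Finset.smul_sum, smul_comm b]
  abel

variable {α γ : ℝ} {β : ℕ → ℝ} {s₀ x₀ : Fin n → Vec r} {η ξ : ℕ → Fin n → Vec r}

theorem algState_succ_fst (γ : ℕ → ℝ) (k : ℕ) :
    (algState W f α γ β s₀ x₀ η ξ (k + 1)).1
      = mix W (algState W f α γ β s₀ x₀ η ξ k).1 + β k • mix (offDiag W) (η k)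
        + γ k • gradStack f (algState W f α γ β s₀ x₀ η ξ k).2 := by
  funext i
  simp only [algState, sum_erase_smul]
  rfl

theorem algState_succ_snd (γ : ℕ → ℝ) (k : ℕ) :
    (algState W f α γ β s₀ x₀ η ξ (k + 1)).2
      = mix W (algState W f α γ β s₀ x₀ η ξ k).2 + β k • mix (offDiag W) (ξ k)
        - α • ((algState W f α γ β s₀ x₀ η ξ (k + 1)).1
          - (algState W f α γ β s₀ x₀ η ξ k).1) := by
  funext i
  simp only [algState, sum_erase_smul]
  rfl

theorem agentAvg_tracker (hW : NetworkAssumption W) (γ : ℝ) (s x : Fin n → Vec r) :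
    agentAvg (tracker W f γ s x) = γ • agentAvg (gradStack f x) := by
  rw [tracker, agentAvg_add, agentAvg_sub, agentAvg_mix hW.col_sum, sub_self, zero_add,
    agentAvg_smul]

/-- The new `s` is `s + z + e` with `z` the tracker. Applying `W - I` to this turns `z` into `W z`,
and the noise `e` appears only as `(W - I) e`. -/
theorem tracker_succ (γ : ℝ) (s e x x' : Fin n → Vec r) :
    tracker W f γ (mix W s + e + γ • gradStack f x) x'
      = zNext W f γ x x' (tracker W f γ s x) + (mix W e - e) := by
  simp only [tracker, zNext, mix_add, mix_sub, mix_smul, smul_sub]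
  abel

theorem algState_increment (k : ℕ) :
    (algState W f α (fun _ => γ) β s₀ x₀ η ξ (k + 1)).1
        - (algState W f α (fun _ => γ) β s₀ x₀ η ξ k).1
      = tracker W f γ (algState W f α (fun _ => γ) β s₀ x₀ η ξ k).1
          (algState W f α (fun _ => γ) β s₀ x₀ η ξ k).2 + β k • mix (offDiag W) (η k) := by
  rw [algState_succ_fst, tracker]
  abel

theorem algState_succ_snd_eq_xNext_add (k : ℕ) :
    (algState W f α (fun _ => γ) β s₀ x₀ η ξ (k + 1)).2
      = xNext W α (algState W f α (fun _ => γ) β s₀ x₀ η ξ k).2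
          (tracker W f γ (algState W f α (fun _ => γ) β s₀ x₀ η ξ k).1
            (algState W f α (fun _ => γ) β s₀ x₀ η ξ k).2)
        + β k • (mix (offDiag W) (ξ k) - α • mix (offDiag W) (η k)) := by
  rw [algState_succ_snd, algState_increment, xNext]
  simp only [smul_add, smul_sub, smul_comm (β k) α]
  abel

/-- The squared entries of a matrix, summed. -/
noncomputable def frobSq (M : Matrix (Fin n) (Fin n) ℝ) : ℝ := ∑ i, ∑ j, M i j ^ 2

theorem frobSq_nonneg (M : Matrix (Fin n) (Fin n) ℝ) : 0 ≤ frobSq M :=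
  Finset.sum_nonneg fun _ _ => Finset.sum_nonneg fun _ _ => sq_nonneg _

/-- Along every path of the algorithm, the three errors are bounded by a geometric sequence plus
the accumulated noise. -/
theorem exists_pathwise_bound (hn : 0 < n) (hW : NetworkAssumption W)
    (hf : ObjectiveAssumption f μ L) {xstar : Vec r}
    (hx : ∀ x, globalObj f xstar ≤ globalObj f x) (hα : 0 < α) (hγ : 0 < γ)
    (hstep : StepsizeCondition W μ L α γ) (s₀ x₀ : Fin n → Vec r) :
    ∃ lam K : ℝ, 0 < lam ∧ lam < 1 ∧ 0 < K ∧
      ∀ (β : ℕ → ℝ) (η ξ : ℕ → Fin n → Vec r) (k : ℕ) (R : ℝ),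
        R = lam ^ k + ∑ l ∈ Finset.range (k + 1), β l ^ 2 * (nsq (η l) + nsq (ξ l)) →
        ‖agentAvg (algState W f α (fun _ => γ) β s₀ x₀ η ξ k).2 - xstar‖ ^ 2 ≤ K * R ∧
        consensusSq (algState W f α (fun _ => γ) β s₀ x₀ η ξ k).2 ≤ K * R ∧
        consensusSq ((algState W f α (fun _ => γ) β s₀ x₀ η ξ (k + 1)).1
          - (algState W f α (fun _ => γ) β s₀ x₀ η ξ k).1) ≤ K * R := by
  obtain ⟨A, c, lam, K, hA, hc, hl0, hl1, hK, hV⟩ :=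
    exists_lyapunov_noisy_step hn hW hf hx hα hγ hstep
  have hμ := hf.mu_pos
  set B := frobSq (offDiag W) with hB
  have hB0 : 0 ≤ B := frobSq_nonneg _
  set B' := frobSq W with hB'
  have hB'0 : 0 ≤ B' := frobSq_nonneg _
  set V₀ := lyapunov A c f xstar x₀ (tracker W f γ s₀ x₀) with hV₀
  have hV₀0 : 0 ≤ V₀ := lyapunov_nonneg hx hA hc _ _
  set K₁ := K * (2 * B + 2 * α ^ 2 * B + 2 * B' * B + 2 * B) with hK₁
  have hK₁0 : 0 ≤ K₁ := by positivity
  set K₂ := V₀ + K₁ with hK₂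
  have hK₂0 : 0 ≤ K₂ := by positivity
  -- One constant for all three errors: `2 / (μ * A) * K₂` for the distance to the minimizer, `K₂`
  -- for the consensus of `x`, and `2 / c * K₂ + 2 * B` for that of `y`.
  refine ⟨lam, 2 / (μ * A) * K₂ + K₂ + 2 / c * K₂ + 2 * B + 1, hl0, hl1, by positivity, ?_⟩
  intro β η ξ k R hR
  set st := algState W f α (fun _ => γ) β s₀ x₀ η ξ with hst
  set S : ℕ → ℝ := fun l => β l ^ 2 * (nsq (η l) + nsq (ξ l)) with hS
  have hS0 : ∀ l, 0 ≤ S l := fun l =>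
    mul_nonneg (sq_nonneg _) (add_nonneg (nsq_nonneg _) (nsq_nonneg _))
  have hstepV : ∀ k, lyapunov A c f xstar (st (k + 1)).2
      (tracker W f γ (st (k + 1)).1 (st (k + 1)).2)
      ≤ lam * lyapunov A c f xstar (st k).2 (tracker W f γ (st k).1 (st k).2) + K₁ * S k := by
    intro k
    have h := hV (st k).2 (tracker W f γ (st k).1 (st k).2)
      (β k • (mix (offDiag W) (ξ k) - α • mix (offDiag W) (η k)))
      (mix W (β k • mix (offDiag W) (η k)) - β k • mix (offDiag W) (η k))
      (agentAvg_tracker hW γ _ _)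
    rw [← algState_succ_snd_eq_xNext_add, ← tracker_succ, ← algState_succ_fst (fun _ => γ) k] at h
    refine h.trans (add_le_add_right ?_ _)
    rw [hK₁, mul_assoc]
    refine mul_le_mul_of_nonneg_left ?_ hK.le
    have hη := nsq_mix_le (offDiag W) (η k)
    have hξ := nsq_mix_le (offDiag W) (ξ k)
    change _ ≤ B * _ at hη
    change _ ≤ B * _ at hξ
    have h1 := nsq_sub_le_two (mix (offDiag W) (ξ k)) (α • mix (offDiag W) (η k))
    rw [nsq_smul] at h1
    have h2 := nsq_sub_le_two (mix W (mix (offDiag W) (η k))) (mix (offDiag W) (η k))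
    have h3 := nsq_mix_le W (mix (offDiag W) (η k))
    change _ ≤ B' * _ at h3
    have h4 := mul_le_mul_of_nonneg_left hη hB'0
    have h5 := mul_le_mul_of_nonneg_left hη (sq_nonneg α)
    rw [mix_smul, ← smul_sub, nsq_smul, nsq_smul, ← mul_add]
    have h6 : nsq (mix (offDiag W) (ξ k) - α • mix (offDiag W) (η k))
        + nsq (mix W (mix (offDiag W) (η k)) - mix (offDiag W) (η k))
        ≤ (2 * B + 2 * α ^ 2 * B + 2 * B' * B + 2 * B) * (nsq (η k) + nsq (ξ k)) := by
      have p1 : 0 ≤ B * nsq (η k) := mul_nonneg hB0 (nsq_nonneg _)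
      have p2 : 0 ≤ (2 * α ^ 2 * B + 2 * B' * B + 2 * B) * nsq (ξ k) :=
        mul_nonneg (by positivity) (nsq_nonneg _)
      linarith
    have h7 := mul_le_mul_of_nonneg_left h6 (sq_nonneg (β k))
    simp only [hS]
    linarith
  have hVk : ∀ k, lyapunov A c f xstar (st k).2 (tracker W f γ (st k).1 (st k).2)
      ≤ lam ^ k * V₀ + K₁ * ∑ l ∈ Finset.range k, S l := by
    intro k
    induction k with
    | zero => simp [hst, algState, hV₀]
    | succ k ih =>
      have h1 := mul_le_mul_of_nonneg_left ih hl0.le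
      have h2 : lam * (K₁ * ∑ l ∈ Finset.range k, S l) ≤ 1 * (K₁ * ∑ l ∈ Finset.range k, S l) :=
        mul_le_mul_of_nonneg_right hl1.le
          (mul_nonneg hK₁0 (Finset.sum_nonneg fun l _ => hS0 l))
      rw [Finset.sum_range_succ, pow_succ]
      linarith [hstepV k]
  have hpow : 0 ≤ lam ^ k := by positivity
  have hsum : 0 ≤ ∑ l ∈ Finset.range k, S l := Finset.sum_nonneg fun l _ => hS0 l
  -- The Lyapunov function at time `k` contains only the noise of times below `k`; the term `S k` is
  -- needed because `y_k` already contains `η_k`.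
  have hR' : R = lam ^ k + (∑ l ∈ Finset.range k, S l + S k) := by
    rw [hR, Finset.sum_range_succ]
  have hR0 : 0 ≤ R := by linarith [hS0 k]
  have hSk : S k ≤ R := by linarith
  have hmain : lyapunov A c f xstar (st k).2 (tracker W f γ (st k).1 (st k).2) ≤ K₂ * R := by
    have h1 : K₂ * (lam ^ k + ∑ l ∈ Finset.range k, S l) ≤ K₂ * R :=
      mul_le_mul_of_nonneg_left (by linarith [hS0 k]) hK₂0
    have h2 : 0 ≤ V₀ * ∑ l ∈ Finset.range k, S l := mul_nonneg hV₀0 hsum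
    have h3 : 0 ≤ K₁ * lam ^ k := mul_nonneg hK₁0 hpow
    rw [hK₂] at h1 ⊢
    linarith [hVk k]
  have q1 : 0 ≤ 2 / (μ * A) * K₂ * R := by positivity
  have q2 : 0 ≤ K₂ * R := by positivity
  have q3 : 0 ≤ 2 / c * K₂ * R := by positivity
  have q4 : 0 ≤ B * R := by positivity
  have hgap0 : 0 ≤ globalObj f (agentAvg (st k).2) - globalObj f xstar := sub_nonneg.2 (hx _)
  have hX0 := consensusSq_nonneg (st k).2
  have hZ0 := consensusSq_nonneg (tracker W f γ (st k).1 (st k).2)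
  have hcZ0 := mul_nonneg hc.le hZ0
  have hn1 : (1 : ℝ) ≤ n := by exact_mod_cast hn
  have hgapn := mul_le_mul_of_nonneg_right hn1 hgap0
  rw [one_mul] at hgapn
  have hAgap := mul_le_mul_of_nonneg_left hgapn hA.le
  have hAgap0 := mul_nonneg hA.le hgap0
  unfold lyapunov at hmain
  refine ⟨?_, by linarith, ?_⟩
  · have h1 := gap_ge_sq hn hf hx (agentAvg (st k).2)
    have h2 : A * (μ / 2 * ‖agentAvg (st k).2 - xstar‖ ^ 2) ≤ K₂ * R := by
      have := mul_le_mul_of_nonneg_left h1 hA.le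
      linarith
    have h3 := mul_le_mul_of_nonneg_left h2 (by positivity : 0 ≤ 2 / (μ * A))
    have h4 : 2 / (μ * A) * (A * (μ / 2 * ‖agentAvg (st k).2 - xstar‖ ^ 2))
        = ‖agentAvg (st k).2 - xstar‖ ^ 2 := by
      field_simp
    linarith
  · rw [algState_increment]
    have h1 := consensusSq_add_le hn one_pos (tracker W f γ (st k).1 (st k).2)
      (β k • mix (offDiag W) (η k))
    rw [nsq_smul] at h1
    have h2 : c * consensusSq (tracker W f γ (st k).1 (st k).2) ≤ K₂ * R := by linarith
    have h3 := mul_le_mul_of_nonneg_left h2 (by positivity : 0 ≤ 2 / c)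
    have h4 : 2 / c * (c * consensusSq (tracker W f γ (st k).1 (st k).2))
        = 2 * consensusSq (tracker W f γ (st k).1 (st k).2) := by
      field_simp
    have h5 := nsq_mix_le (offDiag W) (η k)
    change _ ≤ B * _ at h5
    have h6 := mul_le_mul_of_nonneg_left h5 (sq_nonneg (β k))
    have h7 : β k ^ 2 * (B * nsq (η k)) ≤ B * R := by
      have : β k ^ 2 * nsq (η k) ≤ S k :=
        mul_le_mul_of_nonneg_left (by linarith [nsq_nonneg (ξ k)]) (sq_nonneg _)
      have := mul_le_mul_of_nonneg_left (this.trans hSk) hB0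
      linarith
    norm_num at h1
    linarith

end Perturbation

/-! ### Measurability and passage to expectations. -/

section Noise

variable {n r : ℕ} {W : Matrix (Fin n) (Fin n) ℝ} {f : Fin n → Vec r → ℝ} {μ L : ℝ}
  {Ω : Type*} [MeasurableSpace Ω] {P : Measure Ω}

theorem continuous_gradStack (hf : ObjectiveAssumption f μ L) : Continuous (gradStack f) := by
  refine continuous_pi fun i => ?_
  have h : LipschitzWith L.toNNReal (gradient (f i)) := LipschitzWith.of_dist_le' fun x y => by
    rw [dist_eq_norm, dist_eq_norm]
    exact hf.lipschitz i x y
  exact h.continuous.comp (continuous_apply i)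

theorem continuous_mix (M : Matrix (Fin n) (Fin n) ℝ) :
    Continuous (mix M : (Fin n → Vec r) → Fin n → Vec r) :=
  continuous_pi fun i =>
    continuous_finsetSum _ fun j _ => (continuous_apply j).const_smul (M i j)

theorem continuous_agentAvg : Continuous (agentAvg : (Fin n → Vec r) → Vec r) :=
  (continuous_finsetSum _ fun j _ => continuous_apply j).const_smul (1 / (n : ℝ))

theorem continuous_consensusSq : Continuous (consensusSq : (Fin n → Vec r) → ℝ) :=
  continuous_finsetSum _ fun i _ => ((continuous_apply i).sub continuous_agentAvg).norm.pow 2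

theorem aestronglyMeasurable_stack {ζ : Fin n → Ω → Vec r}
    (h : ∀ i j, MemLp (fun ω => ζ i ω j) 2 P) :
    AEStronglyMeasurable (fun ω i => ζ i ω) P := by
  refine AEMeasurable.aestronglyMeasurable (aemeasurable_pi_iff.2 fun i => ?_)
  have h1 : AEMeasurable (fun ω j => ζ i ω j) P :=
    aemeasurable_pi_iff.2 fun j => (h i j).aestronglyMeasurable.aemeasurable
  exact (PiLp.continuous_toLp 2 (fun _ : Fin r => ℝ)).measurable.comp_aemeasurable h1

theorem integrable_nsq {ζ : Fin n → Ω → Vec r} (h : ∀ i j, MemLp (fun ω => ζ i ω j) 2 P) :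
    Integrable (fun ω => nsq fun i => ζ i ω) P := by
  simp only [nsq_eq_sum_coord]
  exact integrable_finsetSum _ fun c _ => integrable_finsetSum _ fun i _ => (h i c).integrable_sq

theorem aestronglyMeasurable_algState (hf : ObjectiveAssumption f μ L) (α : ℝ) (γ β : ℕ → ℝ)
    (s₀ x₀ : Fin n → Vec r) {η ξ : ℕ → Fin n → Ω → Vec r}
    (hη : ∀ k i j, MemLp (fun ω => η k i ω j) 2 P)
    (hξ : ∀ k i j, MemLp (fun ω => ξ k i ω j) 2 P) (k : ℕ) :
    AEStronglyMeasurable (sIter W f α γ β s₀ x₀ η ξ k) P ∧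
      AEStronglyMeasurable (xIter W f α γ β s₀ x₀ η ξ k) P := by
  induction k with
  | zero => exact ⟨aestronglyMeasurable_const, aestronglyMeasurable_const⟩
  | succ k ih =>
    have hs : AEStronglyMeasurable (sIter W f α γ β s₀ x₀ η ξ (k + 1)) P := by
      have h := (((continuous_mix W).comp_aestronglyMeasurable ih.1).add
        (((continuous_mix (offDiag W)).comp_aestronglyMeasurable
          (aestronglyMeasurable_stack (hη k))).const_smul (β k))).add
        (((continuous_gradStack hf).comp_aestronglyMeasurable ih.2).const_smul (γ k))
      refine h.congr (Eventually.of_forall fun ω => ?_)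
      exact (algState_succ_fst γ k).symm
    refine ⟨hs, ?_⟩
    have h := (((continuous_mix W).comp_aestronglyMeasurable ih.2).add
      (((continuous_mix (offDiag W)).comp_aestronglyMeasurable
        (aestronglyMeasurable_stack (hξ k))).const_smul (β k))).sub
      ((hs.sub ih.1).const_smul α)
    refine h.congr (Eventually.of_forall fun ω => ?_)
    exact (algState_succ_snd γ k).symm

theorem integral_le_of_pathwise [IsProbabilityMeasure P] {η ξ : ℕ → Fin n → Ω → Vec r}
    {ση σξ : ℝ} (hnoise : NoiseAssumption P η ξ ση σξ) (β : ℕ → ℝ) (k : ℕ) {K b : ℝ}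
    (hK : 0 ≤ K) {Q : Ω → ℝ} (hQ : AEStronglyMeasurable Q P) (hQ0 : ∀ ω, 0 ≤ Q ω)
    (hle : ∀ ω, Q ω ≤ K * (b + ∑ l ∈ Finset.range (k + 1),
      β l ^ 2 * (nsq (fun i => η l i ω) + nsq fun i => ξ l i ω))) :
    Integrable Q P ∧
      ∫ ω, Q ω ∂P ≤ K * (b + (∑ l ∈ Finset.range (k + 1), β l ^ 2) * (ση ^ 2 + σξ ^ 2)) := by
  have hη := fun l => integrable_nsq (hnoise.memLp_eta l)
  have hξ := fun l => integrable_nsq (hnoise.memLp_xi l)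
  have hS : ∀ l, Integrable
      (fun ω => β l ^ 2 * (nsq (fun i => η l i ω) + nsq fun i => ξ l i ω)) P :=
    fun l => ((hη l).add (hξ l)).const_mul _
  have hsum := integrable_finsetSum (Finset.range (k + 1)) fun l _ => hS l
  have hR : Integrable (fun ω => K * (b + ∑ l ∈ Finset.range (k + 1),
      β l ^ 2 * (nsq (fun i => η l i ω) + nsq fun i => ξ l i ω))) P :=
    ((integrable_const b).add hsum).const_mul K
  have hint : Integrable Q P := hR.mono' hQ (Eventually.of_forall fun ω => by
    rw [Real.norm_of_nonneg (hQ0 ω)]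
    exact hle ω)
  refine ⟨hint, (integral_mono hint hR hle).trans ?_⟩
  rw [integral_const_mul, integral_add (integrable_const b) hsum, integral_const,
    integral_finsetSum _ fun l _ => hS l, Finset.sum_mul]
  simp only [probReal_univ, one_smul]
  refine mul_le_mul_of_nonneg_left (add_le_add_right (Finset.sum_le_sum fun l _ => ?_) _) hK
  rw [integral_const_mul, integral_add (hη l) (hξ l)]
  exact mul_le_mul_of_nonneg_left (add_le_add (hnoise.var_eta l) (hnoise.var_xi l))
    (sq_nonneg _)

end Noise

/-! ### Choice of `a` and `m`, and the final rate. -/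

theorem gammaSeq_zero (γ m : ℝ) : gammaSeq γ m 0 = fun _ => γ := by
  funext k
  simp [gammaSeq]

theorem betaSeq_sq_le {m q : ℝ} (hm : Real.exp 2 ≤ m) (hq : 0 ≤ q) (l : ℕ) :
    betaSeq m q l ^ 2 ≤ Real.exp (-(4 * q)) := by
  have h1 : Real.exp (2 * q) ≤ (m + l) ^ q := by
    rw [Real.exp_mul]
    exact Real.rpow_le_rpow (Real.exp_pos _).le
      (hm.trans (le_add_of_nonneg_right (Nat.cast_nonneg l))) hq
  have h2 : 0 ≤ betaSeq m q l := by
    have : 0 ≤ m := (Real.exp_pos 2).le.trans hm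
    unfold betaSeq
    positivity
  have h3 : betaSeq m q l ≤ Real.exp (-(2 * q)) := by
    rw [betaSeq, Real.exp_neg, one_div]
    exact inv_anti₀ (Real.exp_pos _) h1
  calc betaSeq m q l ^ 2 ≤ Real.exp (-(2 * q)) ^ 2 := pow_le_pow_left₀ h2 h3 2
    _ = Real.exp (-(4 * q)) := by
      rw [← Real.exp_nat_mul]
      congr 1
      push_cast
      ring

theorem sum_betaSeq_sq_le {m q : ℝ} (hm : Real.exp 2 ≤ m) {k : ℕ} (hk : (k : ℝ) ≤ q) :
    ∑ l ∈ Finset.range (k + 1), betaSeq m q l ^ 2 ≤ Real.exp (-(2 * k)) := by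
  have hq : 0 ≤ q := (Nat.cast_nonneg k).trans hk
  have h1 : ∑ l ∈ Finset.range (k + 1), betaSeq m q l ^ 2 ≤ (k + 1) * Real.exp (-(4 * q)) := by
    have := Finset.sum_le_card_nsmul (Finset.range (k + 1)) _ _
      fun l _ => betaSeq_sq_le hm hq l
    simpa using this
  have h2 : (k : ℝ) + 1 ≤ Real.exp (2 * q) := by
    have := Real.add_one_le_exp (2 * q)
    linarith
  calc _ ≤ (k + 1) * Real.exp (-(4 * q)) := h1
    _ ≤ Real.exp (2 * q) * Real.exp (-(4 * q)) :=
      mul_le_mul_of_nonneg_right h2 (Real.exp_pos _).le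
    _ = Real.exp (-(2 * q)) := by
      rw [← Real.exp_add]
      ring_nf
    _ ≤ Real.exp (-(2 * k)) := Real.exp_le_exp.2 (by linarith)

/-- The equation is solved by `m = 1 / (exp (M / (2q)) - 1)`, which tends to infinity with `q` and
hence eventually exceeds `e²`. -/
theorem eventually_exists_offset {M : ℝ} (hM : 0 < M) :
    ∀ᶠ q : ℝ in atTop, ∃ m : ℝ, Real.exp 2 ≤ m ∧ (m / (m + 1)) ^ (2 * q) = Real.exp (-M) := by
  have ht : Tendsto (fun q : ℝ => Real.exp (M / (2 * q)) - 1) atTop (nhds 0) := by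
    have h1 : Tendsto (fun q : ℝ => M / (2 * q)) atTop (nhds 0) :=
      tendsto_const_nhds.div_atTop (tendsto_id.const_mul_atTop two_pos)
    have h2 := ((Real.continuous_exp.tendsto 0).comp h1).sub_const 1
    simpa using h2
  filter_upwards [eventually_gt_atTop 0, ht.eventually_lt_const (Real.exp_pos (-2))] with q hq he
  have hpos : 0 < Real.exp (M / (2 * q)) - 1 := by
    have := Real.add_one_le_exp (M / (2 * q))
    have : 0 < M / (2 * q) := by positivity
    linarith
  refine ⟨1 / (Real.exp (M / (2 * q)) - 1), ?_, ?_⟩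
  · rw [le_div_iff₀ hpos]
    calc Real.exp 2 * (Real.exp (M / (2 * q)) - 1) ≤ Real.exp 2 * Real.exp (-2) :=
          mul_le_mul_of_nonneg_left he.le (Real.exp_pos _).le
      _ = 1 := by rw [← Real.exp_add]; simp
  · have h1 : 1 / (Real.exp (M / (2 * q)) - 1) / (1 / (Real.exp (M / (2 * q)) - 1) + 1)
        = Real.exp (-(M / (2 * q))) := by
      rw [Real.exp_neg]
      field_simp
      ring
    rw [h1, ← Real.exp_mul]
    congr 1
    field_simp

theorem corollary1 {n r : ℕ} (hn : 0 < n)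
    (W : Matrix (Fin n) (Fin n) ℝ) (hW : NetworkAssumption W)
    (f : Fin n → Vec r → ℝ) (μ L : ℝ) (hf : ObjectiveAssumption f μ L)
    (xstar : Vec r) (hxstar : ∀ x, globalObj f xstar ≤ globalObj f x)
    {Ω : Type*} [MeasurableSpace Ω] (P : Measure Ω) [IsProbabilityMeasure P]
    (η ξ : ℕ → Fin n → Ω → Vec r) (ση σξ : ℝ) (hnoise : NoiseAssumption P η ξ ση σξ)
    (s₀ x₀ : Fin n → Vec r)
    (α γ : ℝ) (hα : 0 < α) (hγ : 0 < γ) (hstep : StepsizeCondition W μ L α γ) :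
    ∃ a C : ℝ, 0 < a ∧ a < 1 ∧ 0 < C ∧
      ∀ᶠ q : ℝ in atTop, ∃ m : ℝ, 0 < m ∧ (m / (m + 1)) ^ (2 * q) = a ∧
        ∀ k : ℕ, (k : ℝ) ≤ q →
          let x := xIter W f α (gammaSeq γ m 0) (betaSeq m q) s₀ x₀ η ξ k
          let y := yIter W f α (gammaSeq γ m 0) (betaSeq m q) s₀ x₀ η ξ k
          let bound := Real.exp (-(4 * (k : ℝ)) / (2 + Real.log (1 / a))) * C
          (Integrable (fun ω => ‖agentAvg (x ω) - xstar‖ ^ 2) P ∧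
            ∫ ω, ‖agentAvg (x ω) - xstar‖ ^ 2 ∂P ≤ bound) ∧
          (Integrable (fun ω => consensusSq (x ω)) P ∧
            ∫ ω, consensusSq (x ω) ∂P ≤ bound) ∧
          (Integrable (fun ω => consensusSq (y ω)) P ∧
            ∫ ω, consensusSq (y ω) ∂P ≤ bound) := by
  obtain ⟨lam, K, hl0, hl1, hK, hpath⟩ := exists_pathwise_bound hn hW hf hxstar hα hγ hstep s₀ x₀
  have hlog : 0 < -Real.log lam := neg_pos.2 (Real.log_neg hl0 hl1)
  -- `M` will be `ln (1 / a)`; it is chosen so that `lam ^ k = exp (-4k / M)`, which is at most `exp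
  -- (-4k / (2 + M))`.
  set M := 4 / -Real.log lam with hM
  have hM0 : 0 < M := by positivity
  have hlogM : Real.log lam = -(4 / M) := by
    rw [hM]
    field_simp
  have hση := hnoise.sigma_eta_pos
  refine ⟨Real.exp (-M), K * (1 + (ση ^ 2 + σξ ^ 2)), Real.exp_pos _, by simpa using hM0,
    by positivity, ?_⟩
  filter_upwards [eventually_exists_offset hM0] with q ⟨m, hm, hma⟩
  refine ⟨m, (Real.exp_pos 2).trans_le hm, hma, fun k hk => ?_⟩
  have hlogA : Real.log (1 / Real.exp (-M)) = M := by simp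
  rw [hlogA, gammaSeq_zero]
  intro x y bound
  set β := betaSeq m q with hβ
  set θ := Real.exp (-(4 * (k : ℝ)) / (2 + M)) with hθ
  have hlam : lam ^ k ≤ θ := by
    rw [← Real.exp_log hl0, ← Real.exp_nat_mul, hlogM, hθ, Real.exp_le_exp]
    have h1 : 4 / (2 + M) ≤ 4 / M := div_le_div_of_nonneg_left (by norm_num) hM0 (by linarith)
    have h2 := mul_le_mul_of_nonneg_left h1 (Nat.cast_nonneg (α := ℝ) k)
    have h3 : -(4 * (k : ℝ)) / (2 + M) = -(k * (4 / (2 + M))) := by ring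
    rw [h3]
    linarith
  -- The noise decays like `exp (-2k)`, and `4 / (2 + M) ≤ 2`.
  have hsum : ∑ l ∈ Finset.range (k + 1), β l ^ 2 ≤ θ := by
    refine (sum_betaSeq_sq_le hm hk).trans (Real.exp_le_exp.2 ?_)
    rw [neg_div, neg_le_neg_iff, div_le_iff₀ (by positivity)]
    have : 0 ≤ (k : ℝ) * M := by positivity
    linarith
  have hbound : K * (lam ^ k + (∑ l ∈ Finset.range (k + 1), β l ^ 2) * (ση ^ 2 + σξ ^ 2))
      ≤ bound := by
    have h1 := mul_le_mul_of_nonneg_right hsum (by positivity : 0 ≤ ση ^ 2 + σξ ^ 2)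
    have h2 := mul_le_mul_of_nonneg_left (add_le_add hlam h1) hK.le
    refine h2.trans (le_of_eq ?_)
    simp only [bound]
    ring
  have hmeas := aestronglyMeasurable_algState (W := W) hf α (fun _ => γ) β s₀ x₀
    hnoise.memLp_eta hnoise.memLp_xi
  have hx : AEStronglyMeasurable x P := (hmeas k).2
  have hy : AEStronglyMeasurable y P := (hmeas (k + 1)).1.sub (hmeas k).1
  have hp := fun ω => hpath β (fun l i => η l i ω) (fun l i => ξ l i ω) k _ rfl
  have key := fun (Q : Ω → ℝ) (hQ : AEStronglyMeasurable Q P) (hQ0 : ∀ ω, 0 ≤ Q ω) hle =>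
    And.imp_right (fun h => h.trans hbound)
      (integral_le_of_pathwise hnoise β k (b := lam ^ k) hK.le hQ hQ0 hle)
  refine ⟨key _ ?_ (fun ω => sq_nonneg _) fun ω => (hp ω).1,
    key _ ?_ (fun ω => consensusSq_nonneg _) fun ω => (hp ω).2.1,
    key _ ?_ (fun ω => consensusSq_nonneg _) fun ω => (hp ω).2.2⟩
  · exact ((continuous_agentAvg.sub continuous_const).norm.pow 2).comp_aestronglyMeasurable hx
  · exact continuous_consensusSq.comp_aestronglyMeasurable hx
  · exact continuous_consensusSq.comp_aestronglyMeasurable hy
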